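/- Let $\ell,n,m\ge 1$ be integers and let $\mathbb K\in\{\mathbb R,\mathbb C\}$. **Systems.** Let $$\Sigma^{H}=\{(E,J,Q,B)\in\mathbb K^{\ell\times n}\times\mathbb K^{\ell\times\ell}\times\mathbb K^{\ell\times n}\times\mathbb K^{\ell\times m} : J=-J^*,\ E^*Q=Q^*E\ge 0\},$$ and let $\Sigma^{sdH}$ (respectively $\Sigma^{dH}$) be the set of quintuples $(E,J,R,Q,B)$ of matrices with $(E,J,Q,B)\in\Sigma^H$, $R\in\mathbb K^{\ell\times\ell}$ and $R=R^*\ge 0$ (respectively $R=R^*>0$). An element describes the port-Hamiltonian descriptor system $\frac{d}{dt}(Ex)=Ax+Bu$ with $A=JQ$ for $\Sigma^H$ and $A=(J-R)Q$ for $\Sigma^{sdH},\Sigma^{dH}$. **Stabilizability.** The behaviour $\mathfrak B$ of $(E,A,B)$ is the set of all pairs $(x,u)$ of locally integrable functions $x:\mathbb R\to\mathbb K^n$, $u:\mathbb R\to\mathbb K^m$ such that $Ex$ is absolutely continuous on every compact interval and $\frac{d}{dt}(Ex)=Ax+Bu$ almost everywhere. The system is * *behaviourally stabilizable* if for every $(x,u)\in\mathfrak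 B$ there is $(x_1,u_1)\in\mathfrak B$ with $(x_1,u_1)(t)=(x,u)(t)$ for all $t<0$ and $\lim_{t\to\infty}\operatorname{ess\,sup}_{\tau\ge t}\|(x_1(\tau),u_1(\tau))\|=0$; * *completely stabilizable* if for every $x^0\in\mathbb K^n$ there is $(x,u)\in\mathfrak B$ such that $x$ is continuous at $0$ with $x(0)=x^0$, and $\lim_{t\to\infty}\operatorname{ess\,sup}_{\tau\ge t}\|x(\tau)\|=0$; * *strongly stabilizable* if for every $x^0\in\mathbb K^n$ there is $(x,u)\in\mathfrak B$ with $Ex(0)=Ex^0$ and $\lim_{t\to\infty}Ex(t)=0$. **Relative genericity.** For $S,V\subseteq\mathbb R^N$, $S$ is *relative generic* in $V$ if there is an algebraic set $\mathbb V\subseteq\mathbb R^N$ (the common zero set of finitely many real polynomials) such that $S^c\cap V\subseteq\mathbb V$ and $\mathbb V^c\cap V$ is Euclidean dense in $V$. For subsets of another finite-dimensional real vector space (complex matrix spaces being regarded as real vector spaces) the notion is transported along a real-linear isomorphism with $\mathbb R^N$. **Theorem.** Let $\Sigma$ be any of $\Sigma^H$, $\Sigma^{sdH}$, $\Sigma^{dH}$,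 and let $S_{b},S_{c},S_{s}\subseteq\Sigma$ be the sets of behaviourally, completely, and strongly stabilizable systems in $\Sigma$. Then: 1. $S_b$ is relative generic in $\Sigma$ if and only if $\ell\ne n+m$; 2. $S_c$ is relative generic in $\Sigma$ if and only if $\ell<n+m$; 3. $S_s$ is relative generic in $\Sigma$ if and only if $\ell<n+m$; 4. if $\ell>n+m$, then $S_c^c$ and $S_s^c$ are relative generic in $\Sigma$; 5. if $\ell=n+m$, then each of $\Sigma\setminus S_b$, $\Sigma\setminus S_c$, $\Sigma\setminus S_s$ has nonempty interior in the relative Euclidean topology of $\Sigma$. -/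

import Mathlib

open Matrix MeasureTheory Filter Topology
open scoped ComplexOrder

namespace PortHamiltonian

/-! ### Relative genericity -/

/-- Algebraic subsets of a real coordinate space: common zero loci of finitely many polynomials. -/
def IsAlgebraicSet {N : ℕ} (A : Set (Fin N → ℝ)) : Prop :=
  ∃ (k : ℕ) (p : Fin k → MvPolynomial (Fin N) ℝ),
    A = {v | ∀ i, MvPolynomial.eval v (p i) = 0}

/-- `S` is relative generic in `V`, for subsets of the coordinate space `ℝ^N`: there is an algebraic
set `A` with `Sᶜ ∩ V ⊆ A ∩ V` and `Aᶜ ∩ V` Euclidean dense in `V`. -/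
def IsRelGenericCoord {N : ℕ} (S V : Set (Fin N → ℝ)) : Prop :=
  ∃ A : Set (Fin N → ℝ), IsAlgebraicSet A ∧ Sᶜ ∩ V ⊆ A ∩ V ∧ V ⊆ closure (Aᶜ ∩ V)

/-- Relative genericity in a finite-dimensional real vector space `W` (in particular in spaces of
tuples of real or of complex matrices, the latter regarded as real vector spaces), by means of a
real-linear isomorphism onto a coordinate space. As such isomorphisms differ by an invertible linear
substitution of the coordinates, the notion does not depend on the isomorphism. -/
def IsRelGeneric {W : Type*} [AddCommGroup W] [Module ℝ W] (S V : Set W) : Prop :=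
  ∃ (N : ℕ) (φ : W ≃ₗ[ℝ] (Fin N → ℝ)), IsRelGenericCoord (φ '' S) (φ '' V)

/-- The subset `T ∩ V` of `V` has nonempty interior in the relative topology of `V`. -/
def HasNonemptyRelInterior {W : Type*} [TopologicalSpace W] (T V : Set W) : Prop :=
  (interior {v : V | (v : W) ∈ T}).Nonempty

variable {𝕜 : Type*} [RCLike 𝕜] {ℓ n m : ℕ}

/-! ### Descriptor systems `d/dt (E x) = A x + B u` -/

/-- The behaviour: pairs `(x, u)` of locally integrable functions on `ℝ` such that `E x` is (locally)
absolutely continuous and `d/dt (E x) = A x + B u` almost everywhere. -/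
def behaviour (E A : Matrix (Fin ℓ) (Fin n) 𝕜) (B : Matrix (Fin ℓ) (Fin m) 𝕜) :
    Set ((ℝ → Fin n → 𝕜) × (ℝ → Fin m → 𝕜)) :=
  {w | LocallyIntegrable w.1 ∧ LocallyIntegrable w.2 ∧
    (∀ a b : ℝ, AbsolutelyContinuousOnInterval (fun t => E *ᵥ w.1 t) a b) ∧
    ∀ᵐ t : ℝ, HasDerivAt (fun s => E *ᵥ w.1 s) (A *ᵥ w.1 t + B *ᵥ w.2 t) t}

/-- `lim_{t → ∞} ess sup_{τ ≥ t} ‖f τ‖ = 0`. -/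
def EssTendstoZero {F : Type*} [NormedAddCommGroup F] (f : ℝ → F) : Prop :=
  Tendsto (fun t : ℝ => essSup (fun τ => ‖f τ‖ₑ) (volume.restrict (Set.Ici t))) atTop (𝓝 0)

/-- Behavioural stabilizability: every past of a trajectory is the past of a trajectory that
tends to zero. -/
def BehaviourallyStabilizable (E A : Matrix (Fin ℓ) (Fin n) 𝕜) (B : Matrix (Fin ℓ) (Fin m) 𝕜) :
    Prop :=
  ∀ w ∈ behaviour E A B, ∃ w₁ ∈ behaviour E A B,
    (∀ t < 0, w.1 t = w₁.1 t ∧ w.2 t = w₁.2 t) ∧ EssTendstoZero (fun τ => (w₁.1 τ, w₁.2 τ))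

/-- Complete stabilizability: from every initial state the state can be steered to zero.
The state is only locally integrable, so its value at the single time `0` is meaningful only together
with continuity there; without that requirement the component of `x 0` in the kernel of `E` could be
changed at will on a null set. -/
def CompletelyStabilizable (E A : Matrix (Fin ℓ) (Fin n) 𝕜) (B : Matrix (Fin ℓ) (Fin m) 𝕜) :
    Prop :=
  ∀ x₀ : Fin n → 𝕜, ∃ w ∈ behaviour E A B,
    (ContinuousAt w.1 0 ∧ w.1 0 = x₀) ∧ EssTendstoZero w.1

/-- Strong stabilizability: from every initial value of `E x`, this quantity can be steered to
zero. -/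
def StronglyStabilizable (E A : Matrix (Fin ℓ) (Fin n) 𝕜) (B : Matrix (Fin ℓ) (Fin m) 𝕜) :
    Prop :=
  ∀ x₀ : Fin n → 𝕜, ∃ w ∈ behaviour E A B,
    E *ᵥ w.1 0 = E *ᵥ x₀ ∧ Tendsto (fun t => E *ᵥ w.1 t) atTop (𝓝 0)

/-! ### Port-Hamiltonian descriptor systems `d/dt (E x) = (J - R) Q x + B u` -/

/-- Quadruples `(E, J, Q, B)`. -/
abbrev Quadruple (𝕜 : Type*) (ℓ n m : ℕ) : Type _ :=
  Matrix (Fin ℓ) (Fin n) 𝕜 × Matrix (Fin ℓ) (Fin ℓ) 𝕜 × Matrix (Fin ℓ) (Fin n) 𝕜 ×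
    Matrix (Fin ℓ) (Fin m) 𝕜

/-- Quintuples `(E, J, R, Q, B)`. -/
abbrev Quintuple (𝕜 : Type*) (ℓ n m : ℕ) : Type _ :=
  Matrix (Fin ℓ) (Fin n) 𝕜 × Matrix (Fin ℓ) (Fin ℓ) 𝕜 × Matrix (Fin ℓ) (Fin ℓ) 𝕜 ×
    Matrix (Fin ℓ) (Fin n) 𝕜 × Matrix (Fin ℓ) (Fin m) 𝕜

/-- Conservative port-Hamiltonian systems: `J = -Jᴴ`, `Eᴴ Q = Qᴴ E ≥ 0`. -/
def SigmaH (𝕜 : Type*) [RCLike 𝕜] (ℓ n m : ℕ) : Set (Quadruple 𝕜 ℓ n m) :=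
  {(E, J, Q, _) | J = -Jᴴ ∧ Eᴴ * Q = Qᴴ * E ∧ (Eᴴ * Q).PosSemidef}

/-- Semi-dissipative port-Hamiltonian systems: in addition `R = Rᴴ ≥ 0`. -/
def SigmaSDH (𝕜 : Type*) [RCLike 𝕜] (ℓ n m : ℕ) : Set (Quintuple 𝕜 ℓ n m) :=
  {(E, J, R, Q, _) | J = -Jᴴ ∧ R.PosSemidef ∧ Eᴴ * Q = Qᴴ * E ∧ (Eᴴ * Q).PosSemidef}

/-- Dissipative port-Hamiltonian systems: in addition `R = Rᴴ > 0`. -/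
def SigmaDH (𝕜 : Type*) [RCLike 𝕜] (ℓ n m : ℕ) : Set (Quintuple 𝕜 ℓ n m) :=
  {(E, J, R, Q, _) | J = -Jᴴ ∧ R.PosDef ∧ Eᴴ * Q = Qᴴ * E ∧ (Eᴴ * Q).PosSemidef}

/-- A property of descriptor systems `(E, A, B)` with the present dimensions. -/
abbrev SystemProperty (𝕜 : Type*) (ℓ n m : ℕ) : Type _ :=
  Matrix (Fin ℓ) (Fin n) 𝕜 → Matrix (Fin ℓ) (Fin n) 𝕜 → Matrix (Fin ℓ) (Fin m) 𝕜 → Prop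

/-- The conservative systems such that `(E, J Q, B)` has the property `P`. -/
def setH (P : SystemProperty 𝕜 ℓ n m) : Set (Quadruple 𝕜 ℓ n m) :=
  {s | s ∈ SigmaH 𝕜 ℓ n m ∧ match s with | (E, J, Q, B) => P E (J * Q) B}

/-- The semi-dissipative systems such that `(E, (J - R) Q, B)` has the property `P`. -/
def setSDH (P : SystemProperty 𝕜 ℓ n m) : Set (Quintuple 𝕜 ℓ n m) :=
  {s | s ∈ SigmaSDH 𝕜 ℓ n m ∧ match s with | (E, J, R, Q, B) => P E ((J - R) * Q) B}

/-- The dissipative systems such that `(E, (J - R) Q, B)` has the property `P`. -/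
def setDH (P : SystemProperty 𝕜 ℓ n m) : Set (Quintuple 𝕜 ℓ n m) :=
  {s | s ∈ SigmaDH 𝕜 ℓ n m ∧ match s with | (E, J, R, Q, B) => P E ((J - R) * Q) B}

end PortHamiltonian

open PortHamiltonian

/-!
Suppose first that `[E, B]` has full rank `min ℓ (n + m)`, which holds generically. A right inverse
`(L; M)` of `[E, B]` (for `ℓ ≤ n + m`) or a left inverse (for `ℓ ≥ n + m`) turns the descriptor
system into an ordinary differential equation with matrix `L A`.

* For `ℓ < n + m` the kernel of `[E, B]` acts as a free input. If the equation is controllable,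
  every state can be steered to zero in finite time, so the system is stabilizable in all three
  senses.
* For `ℓ > n + m` the rows annihilating `[E, B]` give an algebraic constraint. If the equation is
  observable through it, zero is the only trajectory: the system is behaviourally stabilizable for a
  trivial reason, but no nonzero initial state is attained.
* For `ℓ = n + m` the state is determined by its initial value. If `re (tr (L A)) > 0`, Liouville's
  formula shows that some solution does not tend to zero.

The conditions in the first two cases are Zariski open and the one in the third case is Euclidean
open, and each of them holds at an explicit system with `E = Q`. The Zariski open ones are dense
because the systems with `Q = S E` and `S ≥ 0` are dense in `Σ`, and replacing `E` by
`E + t (E₁ - E)` and `S` by `S + t (1 - S)` for `0 ≤ t ≤ 1` gives a quadratic curve inside `Σ` to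
the explicit system: a polynomial that does not vanish at the end of the curve vanishes at only
finitely many parameters `t`.
-/

namespace PortHamiltonian

/-! ### Absolutely continuous primitives -/

section Primitive

theorem absolutelyContinuousOnInterval_of_dist_le {X Y : Type*} [PseudoMetricSpace X]
    [PseudoMetricSpace Y] {f : ℝ → X} {g : ℝ → Y} {a b : ℝ}
    (hg : AbsolutelyContinuousOnInterval g a b) (h : ∀ s t, dist (f s) (f t) ≤ dist (g s) (g t)) :
    AbsolutelyContinuousOnInterval f a b :=
  squeeze_zero (fun _ => Finset.sum_nonneg fun _ _ => dist_nonneg)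
    (fun _ => Finset.sum_le_sum fun _ _ => h _ _) hg

variable {F : Type*} [NormedAddCommGroup F] {f g : ℝ → F}

theorem intervalIntegrable_of_locallyIntegrable (hg : LocallyIntegrable g) (a b : ℝ) :
    IntervalIntegrable g volume a b :=
  intervalIntegrable_iff.2 <|
    (hg.integrableOn_isCompact isCompact_uIcc).mono_set Set.uIoc_subset_uIcc

theorem locallyIntegrable_piecewise_lt (hf : LocallyIntegrable f) (hg : LocallyIntegrable g)
    (c : ℝ) : LocallyIntegrable fun t => if t < c then f t else g t := by
  refine ((hf.indicator (measurableSet_Iio (a := c))).add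
    (hg.indicator (measurableSet_Ici (a := c)))).congr (Eventually.of_forall fun t => ?_)
  rcases lt_or_ge t c with ht | ht
  · simp [ht]
  · simp [ht, not_lt.2 ht]

variable [NormedSpace ℝ F]

theorem absolutelyContinuousOnInterval_integral (hg : LocallyIntegrable g) (c a b : ℝ) :
    AbsolutelyContinuousOnInterval (fun t => ∫ s in c..t, g s) a b := by
  have hi := intervalIntegrable_of_locallyIntegrable hg
  refine absolutelyContinuousOnInterval_of_dist_le
    ((hi a b).norm.absolutelyContinuousOnInterval_intervalIntegral Set.left_mem_uIcc) fun s t => ?_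
  rw [dist_comm, dist_comm (∫ _ in a..s, _), dist_eq_norm, Real.dist_eq,
    intervalIntegral.integral_interval_sub_left (hi c t) (hi c s),
    intervalIntegral.integral_interval_sub_left (hi a t).norm (hi a s).norm]
  exact intervalIntegral.norm_integral_le_abs_integral_norm

theorem absolutelyContinuousOnInterval_and_ae_hasDerivAt_iff [CompleteSpace F]
    (hg : LocallyIntegrable g) :
    ((∀ a b, AbsolutelyContinuousOnInterval f a b) ∧ ∀ᵐ t, HasDerivAt f (g t) t) ↔
      ∀ t, f t = f 0 + ∫ s in 0..t, g s := by
  have hac := absolutelyContinuousOnInterval_integral hg 0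
  have hderiv := _root_.LocallyIntegrable.ae_hasDerivAt_integral hg
  constructor
  · rintro ⟨hf, hd⟩ t
    obtain ⟨C, hC⟩ := ((hf 0 t).fun_sub (hac 0 t)).const_of_ae_hasDerivAt_zero (by
      filter_upwards [hd, hderiv] with s hs hs' _
      simpa only [sub_self] using hs.fun_sub (hs' 0))
    have h0 := hC 0 Set.left_mem_uIcc
    have ht := hC t Set.right_mem_uIcc
    simp only [intervalIntegral.integral_same, sub_zero] at h0
    rw [h0, ← ht, sub_add_cancel]
  · intro h
    have hf : f = fun t => f 0 + ∫ s in 0..t, g s := funext h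
    constructor
    · intro a b
      rw [hf]
      exact absolutelyContinuousOnInterval_of_dist_le (hac a b) fun s t => by simp
    · filter_upwards [hderiv] with t ht
      rw [hf]
      exact (ht 0).const_add _

end Primitive

/-! ### Essential convergence to zero -/

section EssTendstoZero

variable {F G : Type*} [NormedAddCommGroup F] [NormedAddCommGroup G] {f : ℝ → F}

theorem essTendstoZero_of_ae_eq_zero (T : ℝ) (h : ∀ᵐ t : ℝ, T ≤ t → f t = 0) :
    EssTendstoZero f := by
  refine tendsto_const_nhds.congr' ?_
  filter_upwards [eventually_ge_atTop T] with t ht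
  refine (ENNReal.essSup_eq_zero_iff.2 ?_).symm
  rw [Filter.EventuallyEq, ae_restrict_iff' measurableSet_Ici]
  filter_upwards [h] with s hs hts
  simp [hs (ht.trans hts)]

theorem EssTendstoZero.fst {f : ℝ → F × G} (h : EssTendstoZero f) :
    EssTendstoZero fun t => (f t).1 :=
  tendsto_of_tendsto_of_tendsto_of_le_of_le tendsto_const_nhds h (fun _ => zero_le)
    fun _ => essSup_mono_ae (Eventually.of_forall fun t => by
      simpa only [enorm_le_iff_norm_le] using norm_fst_le (f t))

theorem enorm_le_essSup_Ici (hf : Continuous f) (t : ℝ) :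
    ‖f t‖ₑ ≤ essSup (fun s => ‖f s‖ₑ) (volume.restrict (Set.Ici t)) := by
  set b := essSup (fun s => ‖f s‖ₑ) (volume.restrict (Set.Ici t))
  have hdense : Dense {s | s ∈ Set.Ioi t → ‖f s‖ₑ ≤ b} := by
    refine Measure.dense_of_ae (μ := volume) ?_
    filter_upwards [(ae_restrict_iff' measurableSet_Ici).1 (ENNReal.ae_le_essSup _)] with s hs hst
    exact hs (Set.mem_Ici_of_Ioi hst)
  have hclosed : IsClosed {s | ‖f s‖ₑ ≤ b} := isClosed_le hf.enorm continuous_const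
  have hsub : Set.Ioi t ⊆ {s | ‖f s‖ₑ ≤ b} :=
    (hdense.open_subset_closure_inter isOpen_Ioi).trans
      (closure_minimal (fun s hs => hs.2 hs.1) hclosed)
  exact closure_minimal hsub hclosed (by simp)

theorem EssTendstoZero.tendsto_of_continuous (h : EssTendstoZero f) (hf : Continuous f) :
    Tendsto f atTop (𝓝 0) :=
  tendsto_zero_iff_enorm_tendsto_zero.2 <|
    tendsto_of_tendsto_of_tendsto_of_le_of_le tendsto_const_nhds h (fun _ => zero_le)
      (enorm_le_essSup_Ici hf)

end EssTendstoZero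

/-! ### Trajectories -/

section Trajectory

variable {𝕜 : Type*} [RCLike 𝕜] {ℓ n m : ℕ}

/-- Multiplication by a matrix as a real continuous linear map, the form in which it commutes with
derivatives and integrals in the time variable. -/
noncomputable def mulVecCLM (M : Matrix (Fin ℓ) (Fin n) 𝕜) : (Fin n → 𝕜) →L[ℝ] (Fin ℓ → 𝕜) :=
  LinearMap.toContinuousLinearMap (M.mulVecLin.restrictScalars ℝ)

theorem hasDerivAt_mulVec (M : Matrix (Fin ℓ) (Fin n) 𝕜) {x : ℝ → Fin n → 𝕜} {x' : Fin n → 𝕜}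
    {t : ℝ} (h : HasDerivAt x x' t) : HasDerivAt (fun s => M *ᵥ x s) (M *ᵥ x') t :=
  (mulVecCLM M).hasFDerivAt.comp_hasDerivAt t h

theorem continuous_mulVec (M : Matrix (Fin ℓ) (Fin n) 𝕜) {x : ℝ → Fin n → 𝕜} (h : Continuous x) :
    Continuous fun s => M *ᵥ x s :=
  (mulVecCLM M).continuous.comp h

theorem locallyIntegrable_mulVec (M : Matrix (Fin ℓ) (Fin n) 𝕜) {x : ℝ → Fin n → 𝕜}
    (h : LocallyIntegrable x) : LocallyIntegrable fun s => M *ᵥ x s := fun t => by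
  obtain ⟨U, hU, hx⟩ := h t
  exact ⟨U, hU, (mulVecCLM M).integrable_comp hx⟩

theorem mulVec_integral (M : Matrix (Fin ℓ) (Fin n) 𝕜) {x : ℝ → Fin n → 𝕜}
    (h : LocallyIntegrable x) (a b : ℝ) :
    M *ᵥ (∫ s in a..b, x s) = ∫ s in a..b, M *ᵥ x s :=
  ((mulVecCLM M).intervalIntegral_comp_comm (intervalIntegrable_of_locallyIntegrable h a b)).symm

variable {E A : Matrix (Fin ℓ) (Fin n) 𝕜} {B : Matrix (Fin ℓ) (Fin m) 𝕜}
  {w w' : (ℝ → Fin n → 𝕜) × (ℝ → Fin m → 𝕜)}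

theorem mem_behaviour_iff :
    w ∈ behaviour E A B ↔ LocallyIntegrable w.1 ∧ LocallyIntegrable w.2 ∧
      ∀ t, E *ᵥ w.1 t = E *ᵥ w.1 0 + ∫ s in 0..t, (A *ᵥ w.1 s + B *ᵥ w.2 s) := by
  refine and_congr_right fun hx => and_congr_right fun hu => ?_
  exact absolutelyContinuousOnInterval_and_ae_hasDerivAt_iff
    ((locallyIntegrable_mulVec A hx).add (locallyIntegrable_mulVec B hu))

theorem mem_behaviour_of_hasDerivAt {x : ℝ → Fin n → 𝕜} {u : ℝ → Fin m → 𝕜} (hx : Continuous x)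
    (hu : Continuous u) (h : ∀ t, HasDerivAt (fun s => E *ᵥ x s) (A *ᵥ x t + B *ᵥ u t) t) :
    (x, u) ∈ behaviour E A B := by
  refine mem_behaviour_iff.2 ⟨hx.locallyIntegrable, hu.locallyIntegrable, fun t => ?_⟩
  have hcont : Continuous fun s => A *ᵥ x s + B *ᵥ u s :=
    (continuous_mulVec A hx).add (continuous_mulVec B hu)
  rw [intervalIntegral.integral_eq_sub_of_hasDerivAt (fun s _ => h s)
    (hcont.intervalIntegrable 0 t), add_sub_cancel]

theorem concat_mem_behaviour (hw : w ∈ behaviour E A B) (hw' : w' ∈ behaviour E A B)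
    (h0 : E *ᵥ w.1 0 = E *ᵥ w'.1 0) :
    ((fun t => if t < 0 then w.1 t else w'.1 t, fun t => if t < 0 then w.2 t else w'.2 t) :
      (ℝ → Fin n → 𝕜) × (ℝ → Fin m → 𝕜)) ∈ behaviour E A B := by
  rw [mem_behaviour_iff] at hw hw' ⊢
  refine ⟨locallyIntegrable_piecewise_lt hw.1 hw'.1 0,
    locallyIntegrable_piecewise_lt hw.2.1 hw'.2.1 0, fun t => ?_⟩
  rcases lt_or_ge t 0 with ht | ht
  · simp only [ht, if_true, lt_irrefl, if_false, hw.2.2 t, h0]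
    congr 1
    refine intervalIntegral.integral_congr_uIoo fun s hs => ?_
    rw [Set.uIoo_of_ge ht.le] at hs
    simp only [hs.2, if_true]
  · simp only [ht.not_gt, if_false, lt_irrefl, hw'.2.2 t]
    congr 1
    refine intervalIntegral.integral_congr fun s hs => ?_
    rw [Set.uIcc_of_le ht] at hs
    simp only [hs.1.not_gt, if_false]

end Trajectory

/-! ### Controllability and steering to zero -/

section Controllable

open scoped ContDiff

variable {𝕜 : Type*} [RCLike 𝕜] {ℓ n m r : ℕ}

section LinearODE

open scoped Matrix.Norms.Operator

theorem hasDerivAt_exp_smul (F : Matrix (Fin n) (Fin n) 𝕜) (t : ℝ) :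
    HasDerivAt (fun s : ℝ => NormedSpace.exp (s • F)) (F * NormedSpace.exp (t • F)) t :=
  hasDerivAt_exp_smul_const' F t

theorem contDiff_exp_smul (F : Matrix (Fin n) (Fin n) 𝕜) :
    ContDiff ℝ ∞ fun s : ℝ => NormedSpace.exp (s • F) := by
  have hexp : ContDiff ℝ ∞ (NormedSpace.exp : Matrix (Fin n) (Fin n) 𝕜 → _) :=
    contDiff_iff_contDiffAt.2 fun M => (NormedSpace.exp_analytic (𝕂 := ℝ) M).contDiffAt
  exact hexp.comp (contDiff_id.smul contDiff_const)

/-- Evaluation of matrices at a vector as a real continuous linear map. -/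
noncomputable def evalVecCLM (ξ : Fin n → 𝕜) : Matrix (Fin n) (Fin n) 𝕜 →L[ℝ] Fin n → 𝕜 :=
  LinearMap.toContinuousLinearMap (((mulVecBilin 𝕜 𝕜).flip ξ).restrictScalars ℝ)

theorem hasDerivAt_exp_smul_mulVec (F : Matrix (Fin n) (Fin n) 𝕜) (ξ : Fin n → 𝕜) (t : ℝ) :
    HasDerivAt (fun s : ℝ => NormedSpace.exp (s • F) *ᵥ ξ)
      (F *ᵥ (NormedSpace.exp (t • F) *ᵥ ξ)) t := by
  rw [mulVec_mulVec]
  exact (evalVecCLM ξ).hasFDerivAt.comp_hasDerivAt t (hasDerivAt_exp_smul F t)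

theorem contDiff_exp_smul_mulVec (F : Matrix (Fin n) (Fin n) 𝕜) (ξ : Fin n → 𝕜) :
    ContDiff ℝ ∞ fun s : ℝ => NormedSpace.exp (s • F) *ᵥ ξ :=
  (evalVecCLM ξ).contDiff.comp (contDiff_exp_smul F)

end LinearODE

/-- Kalman controllability of `x' = F x + N v` in its geometric form: the whole space is the only
`F`-invariant subspace containing the range of `N`. -/
def IsControllable (F : Matrix (Fin n) (Fin n) 𝕜) (N : Matrix (Fin n) (Fin r) 𝕜) : Prop :=
  ∀ p : Submodule 𝕜 (Fin n → 𝕜), (∀ v, N *ᵥ v ∈ p) → (∀ x ∈ p, F *ᵥ x ∈ p) → p = ⊤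

variable {F : Matrix (Fin n) (Fin n) 𝕜} {N : Matrix (Fin n) (Fin r) 𝕜} {K : Set ℝ}

/-- The forcing terms `g` whose effect on `x' = F x + N v + g` can be confined to the set `K` of
times by a suitable input `v`. -/
def absorbable (F : Matrix (Fin n) (Fin n) 𝕜) (N : Matrix (Fin n) (Fin r) 𝕜) (K : Set ℝ) :
    Submodule 𝕜 (ℝ → Fin n → 𝕜) where
  carrier := {g | ∃ (q : ℝ → Fin n → 𝕜) (v : ℝ → Fin r → 𝕜), Continuous v ∧
    (∀ t ∉ K, q t = 0) ∧ (∀ t ∉ K, v t = 0) ∧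
    ∀ t, HasDerivAt q (F *ᵥ q t + N *ᵥ v t + g t) t}
  zero_mem' := ⟨0, 0, continuous_zero, fun _ _ => rfl, fun _ _ => rfl, fun t => by
    simp [hasDerivAt_zero]⟩
  add_mem' := by
    rintro g g' ⟨q, v, hv, hq0, hv0, hd⟩ ⟨q', v', hv', hq0', hv0', hd'⟩
    refine ⟨q + q', v + v', hv.add hv', fun t ht => by simp [hq0 t ht, hq0' t ht],
      fun t ht => by simp [hv0 t ht, hv0' t ht], fun t => ((hd t).add (hd' t)).congr_deriv ?_⟩
    simp only [Pi.add_apply, mulVec_add]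
    abel
  smul_mem' := by
    rintro c g ⟨q, v, hv, hq0, hv0, hd⟩
    refine ⟨c • q, c • v, hv.const_smul c, fun t ht => by simp [hq0 t ht],
      fun t ht => by simp [hv0 t ht], fun t => ((hd t).const_smul c).congr_deriv ?_⟩
    simp only [Pi.smul_apply, mulVec_smul, smul_add]

theorem smul_mulVec_mem_absorbable {ψ : ℝ → 𝕜} (hψ : Continuous ψ) (hK : tsupport ψ ⊆ K)
    (v : Fin r → 𝕜) : (fun t => ψ t • N *ᵥ v) ∈ absorbable F N K := by
  have h0 : ∀ t ∉ K, ψ t = 0 := fun t ht => image_eq_zero_of_notMem_tsupport fun h => ht (hK h)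
  refine ⟨0, fun t => -ψ t • v, hψ.neg.smul continuous_const, fun _ _ => rfl,
    fun t ht => by simp [h0 t ht], fun t => ?_⟩
  simp [mulVec_neg, mulVec_smul, hasDerivAt_zero]

theorem smul_mulVec_mem_absorbable_of_deriv {ψ : ℝ → 𝕜} (hψ : Differentiable ℝ ψ)
    (hK : tsupport ψ ⊆ K) {η : Fin n → 𝕜}
    (h : (fun t => deriv ψ t • η) ∈ absorbable F N K) :
    (fun t => ψ t • F *ᵥ η) ∈ absorbable F N K := by
  have h0 : ∀ t ∉ K, ψ t = 0 := fun t ht => image_eq_zero_of_notMem_tsupport fun h => ht (hK h)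
  obtain ⟨q, v, hv, hq0, hv0, hd⟩ := h
  refine ⟨fun t => q t - ψ t • η, v, hv, fun t ht => by simp [h0 t ht, hq0 t ht], hv0,
    fun t => ((hd t).sub ((hψ t).hasDerivAt.smul_const η)).congr_deriv ?_⟩
  simp only [mulVec_sub, mulVec_smul]
  abel

theorem IsControllable.smul_mem_absorbable (h : IsControllable F N) {ψ : ℝ → 𝕜}
    (hψ : ContDiff ℝ ∞ ψ) (hK : tsupport ψ ⊆ K) (η : Fin n → 𝕜) :
    (fun t => ψ t • η) ∈ absorbable F N K := by
  let p : Submodule 𝕜 (Fin n → 𝕜) := ⨅ (φ : ℝ → 𝕜) (_ : ContDiff ℝ ∞ φ) (_ : tsupport φ ⊆ K),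
    (absorbable F N K).comap (LinearMap.pi fun t => φ t • LinearMap.id)
  have hp : ∀ {ζ}, ζ ∈ p ↔ ∀ φ : ℝ → 𝕜, ContDiff ℝ ∞ φ → tsupport φ ⊆ K →
      (fun t => φ t • ζ) ∈ absorbable F N K := by
    intro ζ
    simp only [p, Submodule.mem_iInf, Submodule.mem_comap]
    rfl
  have htop : p = ⊤ := h p
    (fun v => hp.2 fun φ hφ hφK => smul_mulVec_mem_absorbable hφ.continuous hφK v)
    (fun x hx => hp.2 fun φ hφ hφK =>
      smul_mulVec_mem_absorbable_of_deriv (hφ.differentiable (by simp)) hφK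
        (hp.1 hx _ (contDiff_infty_iff_deriv.1 hφ).2
          ((closure_minimal (support_deriv_subset) (isClosed_tsupport φ)).trans hφK)))
  exact hp.1 (htop ▸ Submodule.mem_top) ψ hψ hK

theorem IsControllable.mem_absorbable (h : IsControllable F N) {g : ℝ → Fin n → 𝕜}
    (hg : ContDiff ℝ ∞ g) (hK : tsupport g ⊆ K) : g ∈ absorbable F N K := by
  have hsum : g = ∑ i, fun t => g t i • Pi.single i (1 : 𝕜) := by
    funext t
    rw [Finset.sum_apply]
    exact pi_eq_sum_univ' (g t)
  rw [hsum]
  refine Submodule.sum_mem _ fun i _ => h.smul_mem_absorbable (contDiff_pi.1 hg i) ?_ _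
  refine (closure_mono fun t (ht : g t i ≠ 0) => ?_).trans hK
  exact fun hgt => ht (by simp [hgt])

theorem exists_contDiff_cutoff : ∃ χ : ℝ → ℝ, ContDiff ℝ ∞ χ ∧ χ 0 = 1 ∧ (∀ t > 2, χ t = 0) ∧
    tsupport (deriv χ) ⊆ Set.Icc 1 2 := by
  refine ⟨fun t => Real.smoothTransition (2 - t),
    Real.smoothTransition.contDiff.comp (contDiff_const.sub contDiff_id),
    Real.smoothTransition.one_of_one_le (by norm_num),
    fun t ht => Real.smoothTransition.zero_of_nonpos (by linarith),
    closure_minimal (fun t ht => ⟨le_of_not_gt fun ht1 => ht ?_, le_of_not_gt fun ht2 => ht ?_⟩)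
      isClosed_Icc⟩
  · refine (EventuallyEq.deriv_eq (f := fun _ => 1) ?_).trans (deriv_const t _)
    filter_upwards [gt_mem_nhds ht1] with s hs
    exact Real.smoothTransition.one_of_one_le (by linarith)
  · refine (EventuallyEq.deriv_eq (f := fun _ => 0) ?_).trans (deriv_const t _)
    filter_upwards [lt_mem_nhds ht2] with s hs
    exact Real.smoothTransition.zero_of_nonpos (by linarith)

theorem IsControllable.exists_steering (h : IsControllable F N) (ξ : Fin n → 𝕜) :
    ∃ (x : ℝ → Fin n → 𝕜) (v : ℝ → Fin r → 𝕜), Continuous v ∧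
      (∀ t, HasDerivAt x (F *ᵥ x t + N *ᵥ v t) t) ∧ x 0 = ξ ∧ ∀ t > 2, x t = 0 ∧ v t = 0 := by
  obtain ⟨χ, hχ, hχ0, hχ2, hχ'⟩ := exists_contDiff_cutoff
  let y : ℝ → Fin n → 𝕜 := fun t => NormedSpace.exp (t • F) *ᵥ ξ
  -- Cutting off the free motion causes an error on `[1, 2]`, which the input absorbs there.
  let g : ℝ → Fin n → 𝕜 := fun t => -(deriv χ t • y t)
  have hg : ContDiff ℝ ∞ g :=
    ((contDiff_infty_iff_deriv.1 hχ).2.smul (contDiff_exp_smul_mulVec F ξ)).neg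
  have hgK : tsupport g ⊆ Set.Icc 1 2 := by
    refine (closure_mono fun t (ht : g t ≠ 0) => ?_).trans hχ'
    exact fun h0 => ht (by simp [g, h0])
  obtain ⟨q, v, hv, hq0, hv0, hd⟩ := h.mem_absorbable hg hgK
  refine ⟨fun t => χ t • y t + q t, v, hv, fun t => ?_, ?_, fun t ht => ?_⟩
  · refine ((((hχ.differentiable (by simp)) t).hasDerivAt.smul
      (hasDerivAt_exp_smul_mulVec F ξ t)).add (hd t)).congr_deriv ?_
    simp only [y, g, mulVec_add, mulVec_smul]
    abel
  · simp [y, hχ0, hq0 0 (by simp)]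
  · have ht' : t ∉ Set.Icc (1 : ℝ) 2 := fun h => ht.not_ge h.2
    simp [hχ2 t ht, hq0 t ht', hv0 t ht']

/-- A form of `d/dt (E x) = A x + B u` in which the state can be steered: a right inverse `(L; M)`
of `[E, B]` together with solutions `(N; P)` of the homogeneous equation `E N + B P = 0` turns the
system into the controllable equation `x' = L A x + N v` with input `u = -M A x - P v`. -/
def HasControllableForm (E A : Matrix (Fin ℓ) (Fin n) 𝕜) (B : Matrix (Fin ℓ) (Fin m) 𝕜) : Prop :=
  ∃ (r : ℕ) (L : Matrix (Fin n) (Fin ℓ) 𝕜) (M : Matrix (Fin m) (Fin ℓ) 𝕜)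
    (N : Matrix (Fin n) (Fin r) 𝕜) (P : Matrix (Fin m) (Fin r) 𝕜),
    E * L + B * M = 1 ∧ E * N + B * P = 0 ∧ IsControllable (L * A) N

namespace HasControllableForm

variable {E A : Matrix (Fin ℓ) (Fin n) 𝕜} {B : Matrix (Fin ℓ) (Fin m) 𝕜}

theorem exists_steering (h : HasControllableForm E A B) (ξ : Fin n → 𝕜) :
    ∃ w ∈ behaviour E A B, Continuous w.1 ∧ w.1 0 = ξ ∧ ∀ t > 2, w.1 t = 0 ∧ w.2 t = 0 := by
  obtain ⟨r, L, M, N, P, hLM, hNP, hc⟩ := h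
  obtain ⟨x, v, hv, hx, hx0, h2⟩ := hc.exists_steering ξ
  have hxc : Continuous x := continuous_iff_continuousAt.2 fun t => (hx t).continuousAt
  refine ⟨(x, fun t => -(M *ᵥ A *ᵥ x t) - P *ᵥ v t), ?_, hxc, hx0, fun t ht => ?_⟩
  · refine mem_behaviour_of_hasDerivAt hxc ((continuous_mulVec M (continuous_mulVec A hxc)).neg.sub
      (continuous_mulVec P hv)) fun t => (hasDerivAt_mulVec E (hx t)).congr_deriv ?_
    calc E *ᵥ ((L * A) *ᵥ x t + N *ᵥ v t)
        = (E * L) *ᵥ A *ᵥ x t + (E * N) *ᵥ v t := by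
          simp only [mulVec_add, mulVec_mulVec, Matrix.mul_assoc]
      _ = (1 - B * M) *ᵥ A *ᵥ x t + (-(B * P)) *ᵥ v t := by
          rw [eq_sub_of_add_eq hLM, eq_neg_of_add_eq_zero_left hNP]
      _ = A *ᵥ x t + B *ᵥ (-(M *ᵥ A *ᵥ x t) - P *ᵥ v t) := by
          simp only [sub_mulVec, one_mulVec, neg_mulVec, mulVec_sub, mulVec_neg, ← mulVec_mulVec]
          abel
  · simp [h2 t ht]

theorem behaviourallyStabilizable (h : HasControllableForm E A B) :
    BehaviourallyStabilizable E A B := by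
  intro w hw
  obtain ⟨w', hw', -, h0, h2⟩ := h.exists_steering (w.1 0)
  refine ⟨_, concat_mem_behaviour hw hw' (by rw [h0]), fun t ht => by simp [ht], ?_⟩
  refine essTendstoZero_of_ae_eq_zero 3 (Eventually.of_forall fun t ht => ?_)
  simp [h2 t (by linarith), (by linarith : ¬ t < 0)]

theorem completelyStabilizable (h : HasControllableForm E A B) : CompletelyStabilizable E A B := by
  intro ξ
  obtain ⟨w, hw, hc, h0, h2⟩ := h.exists_steering ξ
  exact ⟨w, hw, ⟨hc.continuousAt, h0⟩, essTendstoZero_of_ae_eq_zero 3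
    (Eventually.of_forall fun t ht => (h2 t (by linarith)).1)⟩

theorem stronglyStabilizable (h : HasControllableForm E A B) : StronglyStabilizable E A B := by
  intro ξ
  obtain ⟨w, hw, -, h0, h2⟩ := h.exists_steering ξ
  refine ⟨w, hw, by rw [h0], tendsto_const_nhds.congr' ?_⟩
  filter_upwards [eventually_gt_atTop 2] with t ht
  rw [(h2 t ht).1, mulVec_zero]

end HasControllableForm

end Controllable

/-! ### Liouville's formula -/

section Liouville

open scoped Matrix.Norms.Operator

variable {𝕜 : Type*} [RCLike 𝕜] {n : ℕ} (F : Matrix (Fin n) (Fin n) 𝕜)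

theorem differentiable_det : Differentiable ℝ (det : Matrix (Fin n) (Fin n) 𝕜 → 𝕜) := by
  have hentry : ∀ i j, ContDiff ℝ 1 fun M : Matrix (Fin n) (Fin n) 𝕜 => M i j := fun i j =>
    (LinearMap.toContinuousLinearMap (Matrix.entryLinearMap ℝ 𝕜 i j)).contDiff
  have hprod : ∀ σ : Equiv.Perm (Fin n), Differentiable ℝ
      fun M : Matrix (Fin n) (Fin n) 𝕜 => ∏ i, M (σ i) i := fun σ =>
    (contDiff_prod fun i _ => hentry (σ i) i).differentiable one_ne_zero
  simp only [funext det_apply]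
  exact Differentiable.fun_sum fun σ _ => (hprod σ).const_smul (Equiv.Perm.sign σ)

theorem hasDerivAt_det_one_add_smul :
    HasDerivAt (fun t : ℝ => (1 + t • F).det) F.trace 0 := by
  let q : Polynomial 𝕜 := (det (1 + (Polynomial.X : Polynomial 𝕜) • F.map Polynomial.C)).divX.divX
  have hdet : (fun t : ℝ => (1 + t • F).det) = fun t : ℝ =>
      1 + F.trace * (t : 𝕜) + q.eval (t : 𝕜) * (t : 𝕜) ^ 2 := by
    funext t
    rw [← det_one_add_smul, RCLike.real_smul_eq_coe_smul (K := 𝕜)]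
  have hcoe : HasDerivAt (fun t : ℝ => (t : 𝕜)) 1 0 := by
    simpa using (RCLike.ofRealCLM (K := 𝕜)).hasDerivAt (x := 0)
  have hq : HasDerivAt (fun t : ℝ => q.eval (t : 𝕜)) (q.derivative.eval ((0 : ℝ) : 𝕜) * 1) 0 :=
    (q.hasDerivAt _).comp (0 : ℝ) hcoe
  rw [hdet]
  exact (((hcoe.const_mul F.trace).const_add 1).add (hq.mul (hcoe.pow 2))).congr_deriv (by simp)

theorem hasDerivAt_det_exp_smul (t : ℝ) :
    HasDerivAt (fun s : ℝ => (NormedSpace.exp (s • F)).det)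
      (F.trace * (NormedSpace.exp (t • F)).det) t := by
  have hchain : ∀ {γ : ℝ → Matrix (Fin n) (Fin n) 𝕜}, γ 0 = 1 → HasDerivAt γ F 0 →
      HasDerivAt (fun s => (γ s).det) (fderiv ℝ det (1 : Matrix (Fin n) (Fin n) 𝕜) F) 0 := by
    intro γ h0 hγ
    rw [← h0]
    exact (differentiable_det _).hasFDerivAt.comp_hasDerivAt 0 hγ
  have hline : HasDerivAt (fun s : ℝ => 1 + s • F) F 0 :=
    (((hasDerivAt_id' (0 : ℝ)).smul_const F).const_add 1).congr_deriv (one_smul ℝ F)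
  have hexp : HasDerivAt (fun s : ℝ => NormedSpace.exp (s • F)) F 0 := by
    simpa using hasDerivAt_exp_smul F 0
  have hzero : HasDerivAt (fun s : ℝ => (NormedSpace.exp (s • F)).det) F.trace (t - t) := by
    rw [sub_self, ← (hchain (by simp) hline).unique (hasDerivAt_det_one_add_smul F)]
    exact hchain (by simp) hexp
  refine ((hzero.comp_sub_const t t).mul_const (NormedSpace.exp (t • F)).det).congr_of_eventuallyEq
    (Eventually.of_forall fun s => ?_)
  beta_reduce
  rw [← det_mul, ← exp_add_of_commute, ← add_smul, sub_add_cancel]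
  exact ((Commute.refl F).smul_left _).smul_right _

theorem monotone_norm_det_exp_smul_sq {F : Matrix (Fin n) (Fin n) 𝕜}
    (h : 0 ≤ RCLike.re F.trace) :
    Monotone fun t : ℝ => ‖(NormedSpace.exp (t • F)).det‖ ^ 2 := by
  have hderiv := fun t : ℝ => (hasDerivAt_det_exp_smul F t).norm_sq
  refine monotone_of_deriv_nonneg (fun t => (hderiv t).differentiableAt) fun t => ?_
  rw [(hderiv t).deriv, real_inner_eq_re_inner 𝕜, RCLike.inner_apply, mul_assoc, RCLike.mul_conj]
  norm_cast
  rw [RCLike.re_mul_ofReal]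
  positivity

theorem exists_not_tendsto_exp_smul_mulVec {F : Matrix (Fin n) (Fin n) 𝕜} (hn : 0 < n)
    (h : 0 ≤ RCLike.re F.trace) :
    ∃ ξ, ¬ Tendsto (fun t : ℝ => NormedSpace.exp (t • F) *ᵥ ξ) atTop (𝓝 0) := by
  by_contra! htendsto
  have hexp : Tendsto (fun t : ℝ => NormedSpace.exp (t • F)) atTop (𝓝 0) :=
    tendsto_pi_nhds.2 fun i => tendsto_pi_nhds.2 fun j => by
      simpa using tendsto_pi_nhds.1 (htendsto (Pi.single j 1)) i
  have hdet : Tendsto (fun t : ℝ => ‖(NormedSpace.exp (t • F)).det‖ ^ 2) atTop (𝓝 0) := by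
    have : Nonempty (Fin n) := ⟨⟨0, hn⟩⟩
    simpa using ((differentiable_det.continuous.tendsto 0).comp hexp).norm.pow 2
  have hone : 1 ≤ (0 : ℝ) := ge_of_tendsto hdet <| by
    filter_upwards [eventually_ge_atTop 0] with t ht
    simpa using monotone_norm_det_exp_smul_sq h ht
  exact hone.not_gt one_pos

end Liouville

/-! ### Left-invertible systems -/

section LeftInvertible

variable {𝕜 : Type*} [RCLike 𝕜] {ℓ n m r : ℕ}
  {E A : Matrix (Fin ℓ) (Fin n) 𝕜} {B : Matrix (Fin ℓ) (Fin m) 𝕜}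
  {L : Matrix (Fin n) (Fin ℓ) 𝕜} {w : (ℝ → Fin n → 𝕜) × (ℝ → Fin m → 𝕜)}

theorem mul_mem_behaviour (K : Matrix (Fin r) (Fin ℓ) 𝕜) (hw : w ∈ behaviour E A B) :
    w ∈ behaviour (K * E) (K * A) (K * B) := by
  rw [mem_behaviour_iff] at hw ⊢
  obtain ⟨hx, hu, hint⟩ := hw
  have hrhs : LocallyIntegrable fun s => A *ᵥ w.1 s + B *ᵥ w.2 s :=
    (locallyIntegrable_mulVec A hx).add (locallyIntegrable_mulVec B hu)
  refine ⟨hx, hu, fun t => ?_⟩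
  simp only [← mulVec_mulVec, ← mulVec_add]
  rw [hint t, mulVec_add, mulVec_integral K hrhs]

theorem hasDerivAt_fst_of_mem_behaviour (hLE : L * E = 1) (hLB : L * B = 0)
    (hw : w ∈ behaviour E A B) (t : ℝ) : HasDerivAt w.1 ((L * A) *ᵥ w.1 t) t := by
  obtain ⟨hx, -, hint⟩ := mem_behaviour_iff.1 (mul_mem_behaviour L hw)
  have hFx := intervalIntegrable_of_locallyIntegrable (locallyIntegrable_mulVec (L * A) hx)
  have heq : w.1 = fun t => w.1 0 + ∫ s in 0..t, (L * A) *ᵥ w.1 s := by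
    funext t
    simpa [hLE, hLB] using hint t
  have hcont : Continuous w.1 := by
    rw [heq]
    exact continuous_const.add (intervalIntegral.continuous_primitive hFx 0)
  nth_rw 1 [heq]
  exact (intervalIntegral.integral_hasDerivAt_right (hFx 0 t)
    ((continuous_mulVec _ hcont).stronglyMeasurableAtFilter _ _)
    (continuous_mulVec _ hcont).continuousAt).const_add _

theorem fst_eq_exp_smul_mulVec (hLE : L * E = 1) (hLB : L * B = 0) (hw : w ∈ behaviour E A B) :
    w.1 = fun t => NormedSpace.exp (t • (L * A)) *ᵥ w.1 0 := by
  refine ODE_solution_unique_univ (t₀ := 0) (s := fun _ => Set.univ)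
    (v := fun _ => mulVecCLM (L * A)) (fun _ => (mulVecCLM (L * A)).lipschitz.lipschitzOnWith)
    (fun t => ⟨hasDerivAt_fst_of_mem_behaviour hLE hLB hw t, Set.mem_univ _⟩)
    (fun t => ⟨hasDerivAt_exp_smul_mulVec _ _ t, Set.mem_univ _⟩) (by simp)

end LeftInvertible

/-! ### Observable and unstable systems -/

section Observable

variable {𝕜 : Type*} [RCLike 𝕜] {ℓ n m r : ℕ}

/-- A form of `d/dt (E x) = A x + B u` whose only trajectory is zero: a left inverse `(L; M)` of
`[E, B]` together with a left annihilator `K` of `[E, B]` reduces the system to the equation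
`x' = L A x` with the constraint `K A x = 0`, which is observable. -/
def HasObservableForm (E A : Matrix (Fin ℓ) (Fin n) 𝕜) (B : Matrix (Fin ℓ) (Fin m) 𝕜) : Prop :=
  ∃ (r : ℕ) (L : Matrix (Fin n) (Fin ℓ) 𝕜) (M : Matrix (Fin m) (Fin ℓ) 𝕜)
    (K : Matrix (Fin r) (Fin ℓ) 𝕜), L * E = 1 ∧ L * B = 0 ∧ M * E = 0 ∧ M * B = 1 ∧
    K * E = 0 ∧ K * B = 0 ∧ IsControllable (L * A)ᵀ (K * A)ᵀ

theorem eq_zero_of_isControllable_transpose {F : Matrix (Fin n) (Fin n) 𝕜}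
    {H : Matrix (Fin r) (Fin n) 𝕜} (hc : IsControllable Fᵀ Hᵀ) {x : ℝ → Fin n → 𝕜}
    (hx : ∀ t, HasDerivAt x (F *ᵥ x t) t) (hH : ∀ t, H *ᵥ x t = 0) (t : ℝ) : x t = 0 := by
  let p : Submodule 𝕜 (Fin n → 𝕜) := ⨅ t, LinearMap.ker ((dotProductBilin 𝕜 𝕜).flip (x t))
  have hp : ∀ {η}, η ∈ p ↔ ∀ t, η ⬝ᵥ x t = 0 := by
    intro η
    simp [p]
  have htop : p = ⊤ := by
    refine hc p (fun v => hp.2 fun t => ?_) fun η hη => hp.2 fun t => ?_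
    · rw [mulVec_transpose, ← dotProduct_mulVec, hH, dotProduct_zero]
    · have hderiv : HasDerivAt (fun s => η ⬝ᵥ x s) (η ⬝ᵥ F *ᵥ x t) t :=
        hasDerivAt_pi.1 (hasDerivAt_mulVec (replicateRow (Fin 1) η) (hx t)) 0
      rw [mulVec_transpose, ← dotProduct_mulVec]
      refine hderiv.unique ?_
      simpa only [hp.1 hη] using hasDerivAt_const t (0 : 𝕜)
  exact dotProduct_eq_zero _ fun η => by
    rw [dotProduct_comm]
    exact hp.1 (htop ▸ Submodule.mem_top) t

namespace HasObservableForm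

variable {E A : Matrix (Fin ℓ) (Fin n) 𝕜} {B : Matrix (Fin ℓ) (Fin m) 𝕜}
  {w : (ℝ → Fin n → 𝕜) × (ℝ → Fin m → 𝕜)}

theorem fst_eq_zero (h : HasObservableForm E A B) (hw : w ∈ behaviour E A B) : w.1 = 0 := by
  obtain ⟨r, L, M, K, hLE, hLB, -, -, hKE, hKB, hc⟩ := h
  have hx := hasDerivAt_fst_of_mem_behaviour hLE hLB hw
  have hcont : Continuous w.1 := continuous_iff_continuousAt.2 fun t => (hx t).continuousAt
  have hint : ∀ t, ∫ s in 0..t, (K * A) *ᵥ w.1 s = 0 := fun t => by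
    simpa [hKE, hKB] using ((mem_behaviour_iff.1 (mul_mem_behaviour K hw)).2.2 t).symm
  refine funext fun t => eq_zero_of_isControllable_transpose hc hx (fun t => ?_) t
  have hderiv := (continuous_mulVec (K * A) hcont).integral_hasStrictDerivAt 0 t
  refine hderiv.hasDerivAt.unique ?_
  simpa only [hint] using hasDerivAt_const t (0 : Fin r → 𝕜)

theorem ae_snd_eq_zero (h : HasObservableForm E A B) (hw : w ∈ behaviour E A B) :
    ∀ᵐ t, w.2 t = 0 := by
  have hx := h.fst_eq_zero hw
  obtain ⟨-, -, M, -, -, -, -, hMB, -⟩ := h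
  filter_upwards [hw.2.2.2] with t ht
  have hBu : B *ᵥ w.2 t = 0 := by
    refine HasDerivAt.unique (f := fun s => E *ᵥ w.1 s) (by simpa [hx] using ht) ?_
    simpa [hx] using hasDerivAt_const t (0 : Fin ℓ → 𝕜)
  rw [← one_mulVec (w.2 t), ← hMB, ← mulVec_mulVec, hBu, mulVec_zero]

theorem behaviourallyStabilizable (h : HasObservableForm E A B) :
    BehaviourallyStabilizable E A B := by
  refine fun w hw => ⟨w, hw, fun _ _ => ⟨rfl, rfl⟩, essTendstoZero_of_ae_eq_zero 0 ?_⟩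
  filter_upwards [h.ae_snd_eq_zero hw] with t ht _
  simp [h.fst_eq_zero hw, ht]

theorem not_completelyStabilizable (h : HasObservableForm E A B) (hn : 0 < n) :
    ¬ CompletelyStabilizable E A B := by
  intro hstab
  obtain ⟨w, hw, ⟨-, h0⟩, -⟩ := hstab 1
  rw [h.fst_eq_zero hw] at h0
  exact zero_ne_one (congrFun h0 ⟨0, hn⟩)

theorem not_stronglyStabilizable (h : HasObservableForm E A B) (hn : 0 < n) :
    ¬ StronglyStabilizable E A B := by
  intro hstab
  obtain ⟨w, hw, h0, -⟩ := hstab 1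
  rw [h.fst_eq_zero hw, Pi.zero_apply, mulVec_zero] at h0
  obtain ⟨-, L, -, -, hLE, -⟩ := h
  have h1 : (1 : Fin n → 𝕜) = 0 := by
    rw [← one_mulVec (1 : Fin n → 𝕜), ← hLE, ← mulVec_mulVec, ← h0, mulVec_zero]
  exact one_ne_zero (congrFun h1 ⟨0, hn⟩)

end HasObservableForm

/-- A form of `d/dt (E x) = A x + B u` with unstable free motions: an inverse `(L; M)` of `[E, B]`
turns the system into `x' = L A x`, and the trace of `L A` has positive real part. -/
def HasUnstableForm (E A : Matrix (Fin ℓ) (Fin n) 𝕜) (B : Matrix (Fin ℓ) (Fin m) 𝕜) : Prop :=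
  ∃ (L : Matrix (Fin n) (Fin ℓ) 𝕜) (M : Matrix (Fin m) (Fin ℓ) 𝕜),
    L * E = 1 ∧ L * B = 0 ∧ E * L + B * M = 1 ∧ 0 < RCLike.re (L * A).trace

namespace HasUnstableForm

variable {E A : Matrix (Fin ℓ) (Fin n) 𝕜} {B : Matrix (Fin ℓ) (Fin m) 𝕜}

theorem exists_forall_not_tendsto (h : HasUnstableForm E A B) (hn : 0 < n) :
    ∃ w₀ ∈ behaviour E A B, ∀ w ∈ behaviour E A B, w.1 0 = w₀.1 0 →
      ¬ Tendsto w.1 atTop (𝓝 0) := by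
  obtain ⟨L, M, hLE, hLB, hEB, htr⟩ := h
  obtain ⟨ξ, hξ⟩ := exists_not_tendsto_exp_smul_mulVec hn htr.le
  let x : ℝ → Fin n → 𝕜 := fun t => NormedSpace.exp (t • (L * A)) *ᵥ ξ
  have hx : ∀ t, HasDerivAt x ((L * A) *ᵥ x t) t := hasDerivAt_exp_smul_mulVec (L * A) ξ
  have hxc : Continuous x := continuous_iff_continuousAt.2 fun t => (hx t).continuousAt
  refine ⟨(x, fun t => -(M *ᵥ A *ᵥ x t)), ?_, fun w hw h0 => ?_⟩
  · refine mem_behaviour_of_hasDerivAt hxc (continuous_mulVec M (continuous_mulVec A hxc)).neg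
      fun t => (hasDerivAt_mulVec E (hx t)).congr_deriv ?_
    rw [mulVec_mulVec, ← Matrix.mul_assoc, eq_sub_of_add_eq hEB, Matrix.sub_mul, Matrix.one_mul,
      sub_mulVec, mulVec_neg, ← sub_eq_add_neg]
    simp only [mulVec_mulVec, Matrix.mul_assoc]
  · have hx0 : w.1 0 = ξ := by simp [h0, x]
    rwa [fst_eq_exp_smul_mulVec hLE hLB hw, hx0]

theorem continuous_fst (h : HasUnstableForm E A B)
    {w : (ℝ → Fin n → 𝕜) × (ℝ → Fin m → 𝕜)} (hw : w ∈ behaviour E A B) : Continuous w.1 := by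
  obtain ⟨L, -, hLE, hLB, -⟩ := h
  exact continuous_iff_continuousAt.2 fun t =>
    (hasDerivAt_fst_of_mem_behaviour hLE hLB hw t).continuousAt

theorem not_behaviourallyStabilizable (h : HasUnstableForm E A B) (hn : 0 < n) :
    ¬ BehaviourallyStabilizable E A B := by
  intro hstab
  obtain ⟨w₀, hw₀, hnot⟩ := h.exists_forall_not_tendsto hn
  obtain ⟨w, hw, hpast, hlim⟩ := hstab w₀ hw₀
  have h0 : w.1 0 = w₀.1 0 := by
    refine tendsto_nhds_unique_of_eventuallyEq
      ((h.continuous_fst hw).tendsto 0 |>.mono_left (nhdsWithin_le_nhds (s := Set.Iio 0)))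
      ((h.continuous_fst hw₀).tendsto 0 |>.mono_left nhdsWithin_le_nhds) ?_
    filter_upwards [self_mem_nhdsWithin] with t ht
    exact (hpast t ht).1.symm
  exact hnot w hw h0 (hlim.fst.tendsto_of_continuous (h.continuous_fst hw))

theorem not_completelyStabilizable (h : HasUnstableForm E A B) (hn : 0 < n) :
    ¬ CompletelyStabilizable E A B := by
  intro hstab
  obtain ⟨w₀, -, hnot⟩ := h.exists_forall_not_tendsto hn
  obtain ⟨w, hw, ⟨-, h0⟩, hlim⟩ := hstab (w₀.1 0)
  exact hnot w hw h0 (hlim.tendsto_of_continuous (h.continuous_fst hw))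

theorem not_stronglyStabilizable (h : HasUnstableForm E A B) (hn : 0 < n) :
    ¬ StronglyStabilizable E A B := by
  intro hstab
  obtain ⟨w₀, -, hnot⟩ := h.exists_forall_not_tendsto hn
  obtain ⟨w, hw, h0, hlim⟩ := hstab (w₀.1 0)
  obtain ⟨L, -, hLE, -⟩ := h
  have hinv : ∀ y : Fin n → 𝕜, L *ᵥ E *ᵥ y = y := fun y => by
    rw [mulVec_mulVec, hLE, one_mulVec]
  refine hnot w hw (by rw [← hinv (w.1 0), h0, hinv]) ?_
  have hL := ((mulVecCLM L).continuous.tendsto _).comp hlim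
  rw [map_zero] at hL
  exact hL.congr fun t => hinv (w.1 t)

end HasUnstableForm

end Observable

/-! ### Polynomial functions and genericity -/

theorem hasNonemptyRelInterior_of_eventually_nhds {W : Type*} [TopologicalSpace W]
    {T V : Set W} {v₁ : W} (h₁ : v₁ ∈ V) (h : ∀ᶠ v in 𝓝 v₁, v ∈ V → v ∈ T) :
    HasNonemptyRelInterior T V :=
  ⟨⟨v₁, h₁⟩, mem_interior_iff_mem_nhds.2 <|
    (continuous_subtype_val.tendsto ⟨v₁, h₁⟩).eventually h |>.mono fun v hv => hv v.2⟩

section Polynomial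

variable (𝕜 : Type*) [RCLike 𝕜] (W : Type*) [AddCommGroup W] [Module ℝ W]

/-- The `𝕜`-valued polynomial functions on a real vector space. -/
def polyFun : Subalgebra 𝕜 (W → 𝕜) :=
  Algebra.adjoin 𝕜 (Set.range fun L : W →ₗ[ℝ] 𝕜 => (L : W → 𝕜))

variable {𝕜 W}

/-- Matrices depending polynomially on a point of a real vector space. -/
def IsPolyMatrix {ι κ : Type*} (M : W → Matrix ι κ 𝕜) : Prop :=
  ∀ i j, (fun v => M v i j) ∈ polyFun 𝕜 W

theorem linear_mem_polyFun (L : W →ₗ[ℝ] 𝕜) : (fun v => L v) ∈ polyFun 𝕜 W :=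
  Algebra.subset_adjoin ⟨L, rfl⟩

theorem const_mem_polyFun (c : 𝕜) : (fun _ => c) ∈ polyFun 𝕜 W :=
  (polyFun 𝕜 W).algebraMap_mem c

namespace IsPolyMatrix

variable {ι κ τ : Type*} {M N : W → Matrix ι κ 𝕜}

theorem linear (L : W →ₗ[ℝ] Matrix ι κ 𝕜) : IsPolyMatrix fun v => L v := fun i j =>
  linear_mem_polyFun (entryLinearMap ℝ 𝕜 i j ∘ₗ L)

theorem const (C : Matrix ι κ 𝕜) : IsPolyMatrix fun _ : W => C := fun _ _ => const_mem_polyFun _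

theorem add (hM : IsPolyMatrix M) (hN : IsPolyMatrix N) : IsPolyMatrix fun v => M v + N v :=
  fun i j => add_mem (hM i j) (hN i j)

theorem sub (hM : IsPolyMatrix M) (hN : IsPolyMatrix N) : IsPolyMatrix fun v => M v - N v :=
  fun i j => sub_mem (hM i j) (hN i j)

theorem smul {f : W → 𝕜} (hf : f ∈ polyFun 𝕜 W) (hM : IsPolyMatrix M) :
    IsPolyMatrix fun v => f v • M v := fun i j => mul_mem hf (hM i j)

theorem transpose (hM : IsPolyMatrix M) : IsPolyMatrix fun v => (M v)ᵀ := fun i j => hM j i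

theorem mul [Fintype κ] {P : W → Matrix κ τ 𝕜} (hM : IsPolyMatrix M) (hP : IsPolyMatrix P) :
    IsPolyMatrix fun v => M v * P v := fun i j => by
  have h := sum_mem (t := Finset.univ) fun k _ => mul_mem (hM i k) (hP k j)
  convert h using 1
  ext v
  simp [mul_apply]

theorem fromCols {P : W → Matrix ι τ 𝕜} (hM : IsPolyMatrix M) (hP : IsPolyMatrix P) :
    IsPolyMatrix fun v => Matrix.fromCols (M v) (P v) := fun i => Sum.rec (hM i) (hP i)

variable [Fintype ι] [DecidableEq ι] {S : W → Matrix ι ι 𝕜}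

theorem pow (hS : IsPolyMatrix S) (k : ℕ) : IsPolyMatrix fun v => S v ^ k := by
  induction k with
  | zero => simpa only [pow_zero] using const 1
  | succ k ih => simpa only [pow_succ] using ih.mul hS

theorem det_mem (hS : IsPolyMatrix S) : (fun v => (S v).det) ∈ polyFun 𝕜 W := by
  have h : (fun v => (S v).det) =
      ∑ σ : Equiv.Perm ι, (σ.sign : ℤ) • ∏ i, fun v => S v (σ i) i := by
    ext v
    simp [Matrix.det_apply, Units.smul_def]
  rw [h]
  exact sum_mem fun σ _ => zsmul_mem (prod_mem fun i _ => hS _ _) _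

theorem adjugate (hS : IsPolyMatrix S) : IsPolyMatrix fun v => (S v).adjugate := fun i j => by
  simp only [adjugate_apply]
  refine det_mem fun k l => ?_
  simp only [updateRow_apply]
  split_ifs
  · exact const_mem_polyFun _
  · exact hS k l

end IsPolyMatrix

theorem exists_polynomial_eval_quadratic {f : W → 𝕜} (hf : f ∈ polyFun 𝕜 W) (c₀ c₁ c₂ : W) :
    ∃ p : Polynomial 𝕜, ∀ t : ℝ, f (c₀ + t • c₁ + t ^ 2 • c₂) = p.eval (t : 𝕜) := by
  induction hf using Algebra.adjoin_induction with
  | mem f hf =>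
    obtain ⟨L, rfl⟩ := hf
    refine ⟨.C (L c₀) + .X * .C (L c₁) + .X ^ 2 * .C (L c₂), fun t => ?_⟩
    simp only [map_add, map_smul, RCLike.real_smul_eq_coe_mul, Polynomial.eval_add,
      Polynomial.eval_mul, Polynomial.eval_C, Polynomial.eval_X, Polynomial.eval_pow,
      RCLike.ofReal_pow]
  | algebraMap r => exact ⟨.C r, fun t => by simp⟩
  | add f g _ _ hf hg =>
    obtain ⟨p, hp⟩ := hf
    obtain ⟨q, hq⟩ := hg
    exact ⟨p + q, fun t => by simp [hp, hq]⟩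
  | mul f g _ _ hf hg =>
    obtain ⟨p, hp⟩ := hf
    obtain ⟨q, hq⟩ := hg
    exact ⟨p * q, fun t => by simp [hp, hq]⟩

theorem exists_mvPolynomial_eval_linear {N : ℕ} (φ : W ≃ₗ[ℝ] (Fin N → ℝ)) (g : W →ₗ[ℝ] ℝ) :
    ∃ p : MvPolynomial (Fin N) ℝ, ∀ v, g v = MvPolynomial.eval (φ v) p := by
  refine ⟨∑ i, MvPolynomial.C (g (φ.symm (Pi.single i 1))) * MvPolynomial.X i, fun v => ?_⟩
  have hv := congrArg φ.symm (pi_eq_sum_univ' (φ v))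
  rw [φ.symm_apply_apply, map_sum] at hv
  conv_lhs => rw [hv]
  simp [mul_comm]

theorem exists_mvPolynomial_eval_re_im {N : ℕ} (φ : W ≃ₗ[ℝ] (Fin N → ℝ)) {f : W → 𝕜}
    (hf : f ∈ polyFun 𝕜 W) :
    ∃ p q : MvPolynomial (Fin N) ℝ, ∀ v,
      RCLike.re (f v) = MvPolynomial.eval (φ v) p ∧
      RCLike.im (f v) = MvPolynomial.eval (φ v) q := by
  induction hf using Algebra.adjoin_induction with
  | mem f hf =>
    obtain ⟨L, rfl⟩ := hf
    obtain ⟨p, hp⟩ := exists_mvPolynomial_eval_linear φ (RCLike.reLm ∘ₗ L)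
    obtain ⟨q, hq⟩ := exists_mvPolynomial_eval_linear φ (RCLike.imLm ∘ₗ L)
    exact ⟨p, q, fun v => ⟨hp v, hq v⟩⟩
  | algebraMap r => exact ⟨.C (RCLike.re r), .C (RCLike.im r), fun v => by simp⟩
  | add f g _ _ hf hg =>
    obtain ⟨p, q, h⟩ := hf
    obtain ⟨p', q', h'⟩ := hg
    exact ⟨p + p', q + q', fun v => by simp [(h v).1, (h v).2, (h' v).1, (h' v).2]⟩
  | mul f g _ _ hf hg =>
    obtain ⟨p, q, h⟩ := hf
    obtain ⟨p', q', h'⟩ := hg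
    exact ⟨p * p' - q * q', p * q' + q * p',
      fun v => by simp [(h v).1, (h v).2, (h' v).1, (h' v).2]⟩

variable (𝕜) in
/-- The filter of Zariski neighbourhoods of a point: the sets that contain `{v | f v ≠ 0}` for some
polynomial function `f` that does not vanish at the point. -/
def zariskiNhds (v₁ : W) : Filter W where
  sets := {s | ∃ f ∈ polyFun 𝕜 W, f v₁ ≠ 0 ∧ ∀ v, f v ≠ 0 → v ∈ s}
  univ_sets := ⟨1, one_mem _, one_ne_zero, fun _ _ => Set.mem_univ _⟩
  sets_of_superset := fun ⟨f, hf, h₁, hs⟩ hst => ⟨f, hf, h₁, fun v hv => hst (hs v hv)⟩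
  inter_sets := fun ⟨f, hf, h₁, hs⟩ ⟨g, hg, h₁', ht⟩ =>
    ⟨f * g, mul_mem hf hg, mul_ne_zero h₁ h₁',
      fun v hv => ⟨hs v (left_ne_zero_of_mul hv), ht v (right_ne_zero_of_mul hv)⟩⟩

theorem eventually_zariskiNhds_ne_zero {f : W → 𝕜} (hf : f ∈ polyFun 𝕜 W) {v₁ : W}
    (h₁ : f v₁ ≠ 0) : ∀ᶠ v in zariskiNhds 𝕜 v₁, f v ≠ 0 :=
  ⟨f, hf, h₁, fun _ => id⟩

/-- The points of `V` that can be joined to `v₁` by a quadratic curve inside `V`. Since `Eᴴ * Q` is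
quadratic in `(E, Q)`, segments do not suffice for the systems at hand. -/
def quadraticStar (V : Set W) (v₁ : W) : Set W :=
  {v | ∃ c₁ c₂ : W, v + c₁ + c₂ = v₁ ∧
    ∀ t ∈ Set.Icc (0 : ℝ) 1, v + t • c₁ + t ^ 2 • c₂ ∈ V}

theorem eventually_nhdsNE_eval_ne_zero {p : Polynomial 𝕜} (hp : p ≠ 0) (a : ℝ) :
    ∀ᶠ t : ℝ in 𝓝[≠] a, p.eval (t : 𝕜) ≠ 0 := by
  have hroots : ∀ᶠ z in cofinite, p.eval z ≠ 0 := by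
    refine (p.rootSet_finite 𝕜).subset fun z hz => ?_
    simpa [Polynomial.mem_rootSet, hp] using hz
  exact nhdsNE_le_cofinite a (RCLike.ofReal_injective.tendsto_cofinite.eventually hroots)

section Topology

variable [TopologicalSpace W] [IsTopologicalAddGroup W] [ContinuousSMul ℝ W]

theorem subset_closure_ne_zero_inter {f : W → 𝕜} (hf : f ∈ polyFun 𝕜 W) {V : Set W} {v₁ : W}
    (h₁ : f v₁ ≠ 0) (hV : V ⊆ closure (quadraticStar V v₁)) :
    V ⊆ closure ({v | f v ≠ 0} ∩ V) := by
  refine hV.trans (closure_minimal ?_ isClosed_closure)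
  rintro v ⟨c₁, c₂, hv₁, hc⟩
  obtain ⟨p, hp⟩ := exists_polynomial_eval_quadratic hf v c₁ c₂
  have hp0 : p ≠ 0 := by
    rintro rfl
    have := hp 1
    simp only [one_smul, one_pow, Polynomial.eval_zero] at this
    exact h₁ (hv₁ ▸ this)
  have hcont : Continuous fun t : ℝ => v + t • c₁ + t ^ 2 • c₂ := by fun_prop
  have hlim : Tendsto (fun t : ℝ => v + t • c₁ + t ^ 2 • c₂) (𝓝[>] 0) (𝓝 v) := by
    simpa using (hcont.tendsto 0).mono_left nhdsWithin_le_nhds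
  refine mem_closure_of_tendsto hlim ?_
  filter_upwards [Ioo_mem_nhdsGT one_pos,
    nhdsGT_le_nhdsNE 0 (eventually_nhdsNE_eval_ne_zero hp0 0)] with t ht hpt
  exact ⟨(hp t).trans_ne hpt, hc t ⟨ht.1.le, ht.2.le⟩⟩

theorem IsRelGeneric.subset_closure_inter {S V : Set W} (h : IsRelGeneric S V) :
    V ⊆ closure (S ∩ V) := by
  obtain ⟨N, φ, A, -, hS, hV⟩ := h
  have hφ : Continuous φ.symm := φ.symm.toLinearMap.continuous_of_finiteDimensional
  intro v hv
  have hmem := image_closure_subset_closure_image hφ ⟨φ v, hV ⟨v, hv, rfl⟩, rfl⟩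
  rw [φ.symm_apply_apply] at hmem
  refine closure_mono ?_ hmem
  rintro _ ⟨_, ⟨hx, w, hw, rfl⟩, rfl⟩
  rw [φ.symm_apply_apply]
  refine ⟨by_contra fun hwS => hx (hS ⟨?_, w, hw, rfl⟩).1, hw⟩
  exact fun h => hwS (φ.injective.mem_set_image.1 h)

theorem not_isRelGeneric_of_hasNonemptyRelInterior {S V : Set W}
    (h : HasNonemptyRelInterior Sᶜ V) : ¬ IsRelGeneric S V := by
  intro hS
  obtain ⟨v, hv⟩ := h
  obtain ⟨U, hU, hUo, hvU⟩ := mem_interior.1 hv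
  obtain ⟨U', hU', rfl⟩ := isOpen_induced_iff.1 hUo
  obtain ⟨z, hz, hzS, hzV⟩ := mem_closure_iff.1 (hS.subset_closure_inter v.2) U' hU' hvU
  exact hU (show (⟨z, hzV⟩ : V) ∈ _ from hz) hzS

variable [T2Space W] [FiniteDimensional ℝ W]

theorem continuous_of_mem_polyFun {f : W → 𝕜} (hf : f ∈ polyFun 𝕜 W) : Continuous f := by
  induction hf using Algebra.adjoin_induction with
  | mem f hf =>
    obtain ⟨L, rfl⟩ := hf
    exact L.continuous_of_finiteDimensional
  | algebraMap r => exact continuous_const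
  | add f g _ _ hf hg => exact hf.add hg
  | mul f g _ _ hf hg => exact hf.mul hg

theorem IsPolyMatrix.continuous {ι κ : Type*} {M : W → Matrix ι κ 𝕜} (hM : IsPolyMatrix M) :
    Continuous M :=
  continuous_matrix fun i j => continuous_of_mem_polyFun (hM i j)

theorem nhds_le_zariskiNhds (v₁ : W) : 𝓝 v₁ ≤ zariskiNhds 𝕜 v₁ := by
  rintro s ⟨f, hf, h₁, hs⟩
  exact mem_of_superset ((continuous_of_mem_polyFun hf).continuousAt.eventually_ne h₁) hs

theorem isRelGeneric_of_ne_zero {f : W → 𝕜} (hf : f ∈ polyFun 𝕜 W) {S V : Set W}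
    (hS : ∀ v ∈ V, f v ≠ 0 → v ∈ S) (hV : V ⊆ closure ({v | f v ≠ 0} ∩ V)) :
    IsRelGeneric S V := by
  let φ : W ≃ₗ[ℝ] (Fin (Module.finrank ℝ W) → ℝ) := (Module.finBasis ℝ W).equivFun
  obtain ⟨p, q, h⟩ := exists_mvPolynomial_eval_re_im φ hf
  have hzero : ∀ v, f v = 0 ↔ ∀ i, MvPolynomial.eval (φ v) (![p, q] i) = 0 := by
    intro v
    rw [RCLike.ext_iff (K := 𝕜), (h v).1, (h v).2]
    simp [Fin.forall_fin_two]
  refine ⟨_, φ, {x | ∀ i, MvPolynomial.eval x (![p, q] i) = 0}, ⟨2, ![p, q], rfl⟩, ?_, ?_⟩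
  · rintro _ ⟨hx, v, hv, rfl⟩
    refine ⟨(hzero v).1 ?_, v, hv, rfl⟩
    by_contra hne
    exact hx ⟨v, hS v hv hne, rfl⟩
  · have hφ : Continuous φ := φ.toLinearMap.continuous_of_finiteDimensional
    refine (Set.image_mono hV).trans
      ((image_closure_subset_closure_image hφ).trans (closure_mono ?_))
    rintro _ ⟨v, ⟨hv, hvV⟩, rfl⟩
    exact ⟨fun hc => hv ((hzero v).2 hc), v, hvV, rfl⟩

theorem isRelGeneric_of_eventually_zariskiNhds {S V : Set W} {v₁ : W}
    (hV : V ⊆ closure (quadraticStar V v₁)) (hS : ∀ᶠ v in zariskiNhds 𝕜 v₁, v ∈ V → v ∈ S) :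
    IsRelGeneric S V := by
  obtain ⟨f, hf, h₁, hfS⟩ := hS
  exact isRelGeneric_of_ne_zero hf (fun v hv h => hfS v h hv)
    (subset_closure_ne_zero_inter hf h₁ hV)

end Topology

end Polynomial

/-! ### Openness of the normal forms -/

section Openness

variable {𝕜 : Type*} [RCLike 𝕜] {ℓ n m r : ℕ}

theorem IsControllable.smul {F : Matrix (Fin n) (Fin n) 𝕜} {N : Matrix (Fin n) (Fin r) 𝕜}
    (h : IsControllable F N) {c : 𝕜} (hc : c ≠ 0) : IsControllable (c • F) N := by
  refine fun p hN hF => h p hN fun x hx => ?_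
  have := hF x hx
  rwa [smul_mulVec, p.smul_mem_iff hc] at this

/-- The square submatrix of the Kalman matrix `[N, F N, F² N, …]` whose column `c` is the column
`j c` of the block `F ^ k c * N`. -/
def kalmanMinor (F : Matrix (Fin n) (Fin n) 𝕜) (N : Matrix (Fin n) (Fin r) 𝕜) (k : Fin n → ℕ)
    (j : Fin n → Fin r) : Matrix (Fin n) (Fin n) 𝕜 :=
  of fun i c => (F ^ k c * N) i (j c)

theorem isControllable_of_det_kalmanMinor_ne_zero {F : Matrix (Fin n) (Fin n) 𝕜}
    {N : Matrix (Fin n) (Fin r) 𝕜} {k : Fin n → ℕ} {j : Fin n → Fin r}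
    (h : (kalmanMinor F N k j).det ≠ 0) : IsControllable F N := by
  intro p hN hF
  have hblock : ∀ k v, (F ^ k * N) *ᵥ v ∈ p := by
    intro k v
    induction k with
    | zero => simpa using hN v
    | succ k ih => simpa only [pow_succ', Matrix.mul_assoc, mulVec_mulVec] using hF _ ih
  have hcol : ∀ c, (kalmanMinor F N k j).col c ∈ p := fun c => by
    simpa only [mulVec_single_one] using! hblock (k c) (Pi.single (j c) 1)
  refine Submodule.eq_top_iff'.2 fun x => ?_
  obtain ⟨y, rfl⟩ := mulVec_surjective_iff_isUnit.2
    ((isUnit_iff_isUnit_det _).2 (isUnit_iff_ne_zero.2 h)) x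
  have hrange : LinearMap.range (kalmanMinor F N k j).mulVecLin ≤ p := by
    rw [range_mulVecLin]
    exact Submodule.span_le.2 (Set.range_subset_iff.2 hcol)
  exact hrange ⟨y, rfl⟩

theorem IsControllable.exists_det_kalmanMinor_ne_zero {F : Matrix (Fin n) (Fin n) 𝕜}
    {N : Matrix (Fin n) (Fin r) 𝕜} (h : IsControllable F N) :
    ∃ k j, (kalmanMinor F N k j).det ≠ 0 := by
  let s : Set (Fin n → 𝕜) := Set.range fun a : ℕ × Fin r => (F ^ a.1 * N).col a.2
  have htop : Submodule.span 𝕜 s = ⊤ := by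
    refine h _ (fun v => ?_) fun x hx => ?_
    · have hN : LinearMap.range N.mulVecLin ≤ Submodule.span 𝕜 s := by
        rw [range_mulVecLin]
        refine Submodule.span_mono (Set.range_subset_iff.2 fun j => ⟨(0, j), ?_⟩)
        simp only [pow_zero, Matrix.one_mul]
      exact hN ⟨v, rfl⟩
    · have hle : Submodule.span 𝕜 s ≤ (Submodule.span 𝕜 s).comap F.mulVecLin := by
        rw [Submodule.span_le]
        rintro _ ⟨⟨k, j⟩, rfl⟩
        refine Submodule.subset_span ⟨(k + 1, j), ?_⟩
        simp only [pow_succ', Matrix.mul_assoc]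
        rfl
      exact hle hx
  have hfin : Module.finrank 𝕜 (Submodule.span 𝕜 s) = n := by
    rw [htop, finrank_top, Module.finrank_fin_fun]
  obtain ⟨f, hfs, -, hf⟩ := Submodule.exists_fun_fin_finrank_span_eq 𝕜 s
  choose a ha using fun c => hfs (Fin.cast hfin.symm c)
  refine ⟨fun c => (a c).1, fun c => (a c).2, ?_⟩
  rw [← isUnit_iff_ne_zero, ← isUnit_iff_isUnit_det, ← linearIndependent_cols_iff_isUnit]
  rw [show (kalmanMinor F N (fun c => (a c).1) fun c => (a c).2).col = f ∘ Fin.cast hfin.symm from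
    funext ha]
  exact hf.comp _ (Fin.cast_injective hfin.symm)

variable {W : Type*} [AddCommGroup W] [Module ℝ W]

theorem IsControllable.eventually_zariskiNhds {F : W → Matrix (Fin n) (Fin n) 𝕜}
    {N : W → Matrix (Fin n) (Fin r) 𝕜} (hF : IsPolyMatrix F) (hN : IsPolyMatrix N) {v₁ : W}
    (h : IsControllable (F v₁) (N v₁)) :
    ∀ᶠ v in zariskiNhds 𝕜 v₁, IsControllable (F v) (N v) := by
  obtain ⟨k, j, hkj⟩ := h.exists_det_kalmanMinor_ne_zero
  have hpoly : IsPolyMatrix fun v => kalmanMinor (F v) (N v) k j := fun i c =>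
    ((hF.pow (k c)).mul hN) i (j c)
  exact (eventually_zariskiNhds_ne_zero hpoly.det_mem hkj).mono fun v hv =>
    isControllable_of_det_kalmanMinor_ne_zero hv

variable {E A : W → Matrix (Fin ℓ) (Fin n) 𝕜} {B : W → Matrix (Fin ℓ) (Fin m) 𝕜} {v₁ : W}

theorem hasControllableForm_of_mul_add_mul_eq_smul_one {E A : Matrix (Fin ℓ) (Fin n) 𝕜}
    {B : Matrix (Fin ℓ) (Fin m) 𝕜} {L : Matrix (Fin n) (Fin ℓ) 𝕜} {M : Matrix (Fin m) (Fin ℓ) 𝕜}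
    {N : Matrix (Fin n) (Fin r) 𝕜} {P : Matrix (Fin m) (Fin r) 𝕜} {δ : 𝕜} (hδ : δ ≠ 0)
    (hLM : E * L + B * M = δ • 1) (hNP : E * N + B * P = 0) (hc : IsControllable (L * A) N) :
    HasControllableForm E A B := by
  refine ⟨r, δ⁻¹ • L, δ⁻¹ • M, N, P, ?_, hNP, ?_⟩
  · rw [Matrix.mul_smul, Matrix.mul_smul, ← smul_add, hLM, inv_smul_smul₀ hδ]
  · rw [smul_mul]
    exact hc.smul (inv_ne_zero hδ)

theorem HasControllableForm.eventually_zariskiNhds (hE : IsPolyMatrix E) (hA : IsPolyMatrix A)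
    (hB : IsPolyMatrix B) (h : HasControllableForm (E v₁) (A v₁) (B v₁)) :
    ∀ᶠ v in zariskiNhds 𝕜 v₁, HasControllableForm (E v) (A v) (B v) := by
  obtain ⟨r, L, M, N, P, hLM, hNP, hc⟩ := h
  -- Near `v₁` the residuals of the two equations are repaired by means of the adjugate of `D`.
  let D v := E v * L + B v * M
  let G v := (D v).adjugate
  let δ v := (D v).det
  let T v := E v * N + B v * P
  let N' v := δ v • N - L * G v * T v
  have hD : IsPolyMatrix D := (hE.mul (.const L)).add (hB.mul (.const M))
  have hT : IsPolyMatrix T := (hE.mul (.const N)).add (hB.mul (.const P))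
  have hLG : IsPolyMatrix fun v => L * G v := (IsPolyMatrix.const L).mul hD.adjugate
  have hN' : IsPolyMatrix N' := ((IsPolyMatrix.const N).smul hD.det_mem).sub (hLG.mul hT)
  have hDG : ∀ v, E v * (L * G v) + B v * (M * G v) = δ v • 1 := fun v => by
    rw [← Matrix.mul_assoc, ← Matrix.mul_assoc, ← Matrix.add_mul, mul_adjugate]
  have hc₁ : IsControllable (L * G v₁ * A v₁) (N' v₁) := by
    simpa [N', G, δ, D, T, hLM, hNP] using hc
  have hδ₁ : δ v₁ ≠ 0 := by simp [δ, D, hLM]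
  filter_upwards [eventually_zariskiNhds_ne_zero hD.det_mem hδ₁,
    hc₁.eventually_zariskiNhds (hLG.mul hA) hN'] with v hδ hcv
  refine hasControllableForm_of_mul_add_mul_eq_smul_one (P := δ v • P - M * G v * T v) hδ (hDG v)
    ?_ hcv
  calc E v * N' v + B v * (δ v • P - M * G v * T v)
      = δ v • T v - (E v * (L * G v) + B v * (M * G v)) * T v := by
        simp only [N', T, Matrix.mul_sub, Matrix.mul_smul, smul_add, Matrix.add_mul,
          Matrix.mul_assoc]
        abel
    _ = 0 := by rw [hDG, smul_mul, Matrix.one_mul, sub_self]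

theorem hasObservableForm_of_mul_fromCols_eq_smul_one {E A : Matrix (Fin ℓ) (Fin n) 𝕜}
    {B : Matrix (Fin ℓ) (Fin m) 𝕜} {Z : Matrix (Fin n ⊕ Fin m) (Fin ℓ) 𝕜}
    {K : Matrix (Fin r) (Fin ℓ) 𝕜} {δ : 𝕜} (hδ : δ ≠ 0) (hZ : Z * fromCols E B = δ • 1)
    (hK : K * fromCols E B = 0) (hc : IsControllable (Z.toRows₁ * A)ᵀ (K * A)ᵀ) :
    HasObservableForm E A B := by
  rw [← fromRows_toRows Z, fromRows_mul_fromCols, ← fromBlocks_one, fromBlocks_smul,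
    fromBlocks_inj, smul_zero, smul_zero] at hZ
  rw [mul_fromCols, ← fromCols_zero] at hK
  obtain ⟨hLE, hLB, hME, hMB⟩ := hZ
  obtain ⟨hKE, hKB⟩ := fromCols_inj hK
  refine ⟨r, δ⁻¹ • Z.toRows₁, δ⁻¹ • Z.toRows₂, K, ?_, ?_, ?_, ?_, hKE, hKB, ?_⟩
  · rw [smul_mul, hLE, inv_smul_smul₀ hδ]
  · rw [smul_mul, hLB, smul_zero]
  · rw [smul_mul, hME, smul_zero]
  · rw [smul_mul, hMB, inv_smul_smul₀ hδ]
  · rw [smul_mul, transpose_smul]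
    exact hc.smul (inv_ne_zero hδ)

theorem HasObservableForm.eventually_zariskiNhds (hE : IsPolyMatrix E) (hA : IsPolyMatrix A)
    (hB : IsPolyMatrix B) (h : HasObservableForm (E v₁) (A v₁) (B v₁)) :
    ∀ᶠ v in zariskiNhds 𝕜 v₁, HasObservableForm (E v) (A v) (B v) := by
  obtain ⟨r, L, M, K, hLE, hLB, hME, hMB, hKE, hKB, hc⟩ := h
  let C v := fromCols (E v) (B v)
  let D v := fromRows L M * C v
  let G v := (D v).adjugate
  let δ v := (D v).det
  let Z v := G v * fromRows L M
  let K' v := δ v • K - K * C v * Z v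
  have hC : IsPolyMatrix C := hE.fromCols hB
  have hD : IsPolyMatrix D := (IsPolyMatrix.const _).mul hC
  have hZ : IsPolyMatrix Z := hD.adjugate.mul (.const _)
  have hK' : IsPolyMatrix K' :=
    ((IsPolyMatrix.const K).smul hD.det_mem).sub (((IsPolyMatrix.const K).mul hC).mul hZ)
  have hZC : ∀ v, Z v * C v = δ v • 1 := fun v => by
    rw [Matrix.mul_assoc, adjugate_mul]
  have hD₁ : D v₁ = 1 := by
    simp only [D, C, fromRows_mul_fromCols, hLE, hLB, hME, hMB, fromBlocks_one]
  have hKC₁ : K * C v₁ = 0 := by rw [mul_fromCols, hKE, hKB, fromCols_zero]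
  have hc₁ : IsControllable ((Z v₁).toRows₁ * A v₁)ᵀ (K' v₁ * A v₁)ᵀ := by
    simpa [K', Z, G, δ, hD₁, hKC₁] using hc
  have hδ₁ : δ v₁ ≠ 0 := by simp [δ, hD₁]
  have hLA : IsPolyMatrix fun v => (Z v).toRows₁ * A v :=
    IsPolyMatrix.mul (fun i j => hZ (.inl i) j) hA
  filter_upwards [eventually_zariskiNhds_ne_zero hD.det_mem hδ₁,
    hc₁.eventually_zariskiNhds hLA.transpose (hK'.mul hA).transpose] with v hδ hcv
  refine hasObservableForm_of_mul_fromCols_eq_smul_one hδ (hZC v) ?_ hcv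
  change K' v * C v = 0
  rw [Matrix.sub_mul, smul_mul, Matrix.mul_assoc _ (Z v), hZC, Matrix.mul_smul, Matrix.mul_one,
    sub_self]

theorem mul_eq_one_and_mul_eq_zero_of_right_inverse (h : ℓ = n + m) {E : Matrix (Fin ℓ) (Fin n) 𝕜}
    {B : Matrix (Fin ℓ) (Fin m) 𝕜} {L : Matrix (Fin n) (Fin ℓ) 𝕜} {M : Matrix (Fin m) (Fin ℓ) 𝕜}
    (hLM : E * L + B * M = 1) : L * E = 1 ∧ L * B = 0 := by
  have hone := (fromCols_mul_fromRows_eq_one_comm ((finCongr h).trans finSumFinEquiv.symm) E B L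
    M).1 ((fromCols_mul_fromRows E B L M).trans hLM)
  rw [fromRows_mul_fromCols, ← fromBlocks_one, fromBlocks_inj] at hone
  exact ⟨hone.1, hone.2.1⟩

theorem HasUnstableForm.eventually_nhds {X : Type*} [TopologicalSpace X]
    {E A : X → Matrix (Fin ℓ) (Fin n) 𝕜} {B : X → Matrix (Fin ℓ) (Fin m) 𝕜} {v₁ : X}
    (hℓ : ℓ = n + m) (hE : Continuous E) (hA : Continuous A)
    (hB : Continuous B) (h : HasUnstableForm (E v₁) (A v₁) (B v₁)) :
    ∀ᶠ v in 𝓝 v₁, HasUnstableForm (E v) (A v) (B v) := by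
  obtain ⟨L, M, -, -, hLM, htr⟩ := h
  let D v := E v * L + B v * M
  have hD : Continuous D := by fun_prop
  have hD₁ : D v₁ = 1 := hLM
  have hdet : ∀ᶠ v in 𝓝 v₁, (D v).det ≠ 0 :=
    hD.matrix_det.continuousAt.eventually_ne (by simp [hD₁])
  have hinv : ContinuousAt (fun v => (D v)⁻¹) v₁ := by
    refine (continuousAt_matrix_inv _ ?_).comp hD.continuousAt
    rw [Ring.inverse_eq_inv']
    exact continuousAt_inv₀ (by simp [hD₁])
  have htrace : ∀ᶠ v in 𝓝 v₁, 0 < RCLike.re (L * (D v)⁻¹ * A v).trace := by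
    have hcont : ContinuousAt (fun v => RCLike.re (L * (D v)⁻¹ * A v).trace) v₁ := by fun_prop
    exact hcont.eventually (lt_mem_nhds (by simpa [hD₁] using htr))
  filter_upwards [hdet, htrace] with v hdet htr
  have hone : E v * (L * (D v)⁻¹) + B v * (M * (D v)⁻¹) = 1 := by
    rw [← Matrix.mul_assoc, ← Matrix.mul_assoc, ← Matrix.add_mul,
      mul_nonsing_inv _ (isUnit_iff_ne_zero.2 hdet)]
  obtain ⟨hLE, hLB⟩ := mul_eq_one_and_mul_eq_zero_of_right_inverse hℓ hone
  exact ⟨_, _, hLE, hLB, hone, htr⟩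

end Openness

/-! ### Reference systems -/

section Reference

variable {𝕜 : Type*} [RCLike 𝕜] {ℓ n m : ℕ}

/-- The rectangular identity matrix. -/
def rectOne (𝕜 : Type*) [RCLike 𝕜] (ℓ n : ℕ) : Matrix (Fin ℓ) (Fin n) 𝕜 :=
  of fun i j => if (i : ℕ) = j then 1 else 0

/-- The skew-symmetric tridiagonal matrix with entries `±1`. -/
def skewTridiag (𝕜 : Type*) [RCLike 𝕜] (ℓ : ℕ) : Matrix (Fin ℓ) (Fin ℓ) 𝕜 :=
  of fun i j => if (j : ℕ) = i + 1 then 1 else if (i : ℕ) = j + 1 then -1 else 0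

/-- The matrix `A = (J - R) Q` of the reference systems, in which `E = Q = rectOne`,
`J = skewTridiag` and `R = ρ`. -/
def referenceMatrix (ℓ n : ℕ) (ρ : 𝕜) : Matrix (Fin ℓ) (Fin n) 𝕜 :=
  (skewTridiag 𝕜 ℓ - ρ • 1) * rectOne 𝕜 ℓ n

theorem sum_ite_val_eq (f : Fin n → 𝕜) (a : ℕ) :
    ∑ i : Fin n, (if (i : ℕ) = a then f i else 0) = if h : a < n then f ⟨a, h⟩ else 0 := by
  split_ifs with h
  · rw [Finset.sum_eq_single ⟨a, h⟩ (fun i _ hi => if_neg fun hia => hi (Fin.ext hia))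
      (fun hmem => absurd (Finset.mem_univ _) hmem), if_pos rfl]
  · exact Finset.sum_eq_zero fun i _ => if_neg fun hia => h (hia.symm.trans_lt i.2)

theorem rectOne_mul_apply {κ : Type*} (M : Matrix (Fin n) κ 𝕜) (i : Fin ℓ) (j : κ) :
    (rectOne 𝕜 ℓ n * M) i j = if h : (i : ℕ) < n then M ⟨i, h⟩ j else 0 := by
  simp only [mul_apply, rectOne, of_apply, ite_mul, one_mul, zero_mul, eq_comm (a := (i : ℕ)),
    sum_ite_val_eq]

theorem mul_rectOne_apply {κ : Type*} (M : Matrix κ (Fin ℓ) 𝕜) (i : κ) (j : Fin n) :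
    (M * rectOne 𝕜 ℓ n) i j = if h : (j : ℕ) < ℓ then M i ⟨j, h⟩ else 0 := by
  simp only [mul_apply, rectOne, of_apply, mul_ite, mul_one, mul_zero, sum_ite_val_eq]

theorem referenceMatrix_apply (ρ : 𝕜) (i : Fin ℓ) (j : Fin n) :
    referenceMatrix ℓ n ρ i j = if ℓ ≤ j then 0 else if (j : ℕ) = i + 1 then 1 else
      if (i : ℕ) = j + 1 then -1 else if (i : ℕ) = j then -ρ else 0 := by
  rw [referenceMatrix, mul_rectOne_apply]
  simp only [skewTridiag, Matrix.sub_apply, Matrix.smul_apply, of_apply, one_apply, Fin.ext_iff,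
    smul_eq_mul]
  split_ifs <;> first | omega | simp

theorem skewTridiag_eq_neg_conjTranspose : skewTridiag 𝕜 ℓ = -(skewTridiag 𝕜 ℓ)ᴴ := by
  ext i j
  simp only [skewTridiag, conjTranspose_apply, Matrix.neg_apply, of_apply]
  split_ifs <;> first | omega | simp

/-- The standard basis vectors of `𝕜ⁿ`, continued by zero to all indices. -/
def basisVec (𝕜 : Type*) [RCLike 𝕜] (n k : ℕ) : Fin n → 𝕜 := fun i => if (i : ℕ) = k then 1 else 0

theorem basisVec_eq_zero {k : ℕ} (h : n ≤ k) : basisVec 𝕜 n k = 0 :=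
  funext fun i => if_neg (i.2.trans_le h).ne

theorem mulVec_basisVec {κ : Type*} (M : Matrix κ (Fin n) 𝕜) (k : ℕ) (i : κ) :
    (M *ᵥ basisVec 𝕜 n k) i = if h : k < n then M i ⟨k, h⟩ else 0 := by
  simp only [mulVec, dotProduct, basisVec, mul_ite, mul_one, mul_zero, sum_ite_val_eq]

theorem eq_top_of_basisVec_mem {p : Submodule 𝕜 (Fin n → 𝕜)} (h : ∀ k, basisVec 𝕜 n k ∈ p) :
    p = ⊤ := by
  refine Submodule.eq_top_iff'.2 fun x => ?_
  have hx : x = ∑ k, x k • basisVec 𝕜 n k := by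
    ext i
    simp [basisVec, Fin.val_inj]
  rw [hx]
  exact p.sum_mem fun k _ => p.smul_mem _ (h k)

theorem isControllable_referenceMatrix (ρ : 𝕜) :
    IsControllable (rectOne 𝕜 n ℓ * referenceMatrix ℓ n ρ)
      (diagonal fun j : Fin n => if (j : ℕ) = 0 then -1 else if ℓ ≤ j then 1 else 0) := by
  intro p hN hF
  have hfirst : basisVec 𝕜 n 0 ∈ p := by
    convert hN (-basisVec 𝕜 n 0) using 1
    ext i
    simp only [mulVec_diagonal, Pi.neg_apply, basisVec]
    split_ifs <;> simp
  have hlast : ∀ k, ℓ ≤ k → basisVec 𝕜 n k ∈ p := fun k hk => by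
    obtain rfl | hk0 := Nat.eq_zero_or_pos k
    · exact hfirst
    convert hN (basisVec 𝕜 n k) using 1
    ext i
    simp only [mulVec_diagonal, basisVec]
    split_ifs <;> first | omega | simp
  have hrec : ∀ k < n, k + 1 < ℓ → basisVec 𝕜 n (k + 1) =
      (if k = 0 then 0 else basisVec 𝕜 n (k - 1)) - ρ • basisVec 𝕜 n k -
        (rectOne 𝕜 n ℓ * referenceMatrix ℓ n ρ) *ᵥ basisVec 𝕜 n k := by
    intro k hkn hk
    ext i
    simp only [Pi.sub_apply, mulVec_basisVec, rectOne_mul_apply, referenceMatrix_apply,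
      Pi.smul_apply, smul_eq_mul, basisVec, apply_ite (fun f : Fin n → 𝕜 => f i), Pi.zero_apply]
    split_ifs <;> first | omega | simp
  refine eq_top_of_basisVec_mem fun k => ?_
  induction k using Nat.strong_induction_on with
  | _ k ih =>
    obtain hk | hk := le_or_gt ℓ k
    · exact hlast k hk
    cases k with
    | zero => exact hfirst
    | succ k =>
      obtain hkn | hkn := le_or_gt n k
      · rw [basisVec_eq_zero (hkn.trans k.le_succ)]
        exact p.zero_mem
      rw [hrec k hkn hk]
      refine sub_mem (sub_mem ?_ (p.smul_mem _ (ih k k.lt_succ_self))) (hF _ (ih k k.lt_succ_self))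
      split_ifs
      · exact p.zero_mem
      · exact ih _ (by omega)

theorem isControllable_transpose_referenceMatrix (hℓ : n < ℓ) (ρ : 𝕜) :
    IsControllable (rectOne 𝕜 n ℓ * referenceMatrix ℓ n ρ)ᵀ
      ((of fun (_ : Fin 1) (j : Fin ℓ) => if (j : ℕ) = n then (1 : 𝕜) else 0) *
        referenceMatrix ℓ n ρ)ᵀ := by
  intro p hN hF
  have hlast : basisVec 𝕜 n (n - 1) ∈ p := by
    convert hN (-basisVec 𝕜 1 0) using 1
    ext i
    simp only [mulVec_neg, Pi.neg_apply, mulVec_basisVec, transpose_apply, mul_apply, of_apply,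
      ite_mul, one_mul, zero_mul, sum_ite_val_eq, referenceMatrix_apply, basisVec]
    split_ifs <;> first | omega | simp
  have hrec : ∀ k, 0 < k → k < n → basisVec 𝕜 n (k - 1) = basisVec 𝕜 n (k + 1) -
      ρ • basisVec 𝕜 n k - (rectOne 𝕜 n ℓ * referenceMatrix ℓ n ρ)ᵀ *ᵥ basisVec 𝕜 n k := by
    intro k hk0 hk
    ext i
    simp only [Pi.sub_apply, mulVec_basisVec, transpose_apply, rectOne_mul_apply,
      referenceMatrix_apply, Pi.smul_apply, smul_eq_mul, basisVec]
    split_ifs <;> first | omega | simp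
  have hdown : ∀ d k, n ≤ k + d → basisVec 𝕜 n k ∈ p := by
    intro d
    induction d using Nat.strong_induction_on with
    | _ d ih =>
      intro k hk
      obtain hkn | rfl | hkn : n ≤ k ∨ k = n - 1 ∨ k + 1 < n := by omega
      · rw [basisVec_eq_zero hkn]
        exact p.zero_mem
      · exact hlast
      rw [show k = k + 1 - 1 from rfl, hrec (k + 1) k.succ_pos hkn]
      have hmem := ih (d - 1) (by omega) (k + 1) (by omega)
      exact sub_mem (sub_mem (ih (d - 2) (by omega) _ (by omega)) (p.smul_mem _ hmem)) (hF _ hmem)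
  exact eq_top_of_basisVec_mem fun k => hdown n k (by omega)

theorem exists_hasControllableForm (h : ℓ < n + m) (hn : 0 < n) (hm : 0 < m) (ρ : 𝕜) :
    ∃ B : Matrix (Fin ℓ) (Fin m) 𝕜,
      HasControllableForm (rectOne 𝕜 ℓ n) (referenceMatrix ℓ n ρ) B := by
  let B : Matrix (Fin ℓ) (Fin m) 𝕜 := of fun i c =>
    if (c : ℕ) = 0 then if (i : ℕ) = 0 then 1 else 0 else if (i : ℕ) + 1 = n + c then 1 else 0
  let M : Matrix (Fin m) (Fin ℓ) 𝕜 := of fun c j =>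
    if (c : ℕ) = j + 1 - n then if n ≤ j then 1 else 0 else 0
  let P : Matrix (Fin m) (Fin n) 𝕜 := of fun c j =>
    if (c : ℕ) = 0 then if (j : ℕ) = 0 then 1 else 0 else 0
  refine ⟨B, n, rectOne 𝕜 n ℓ, M, _, P, ?_, ?_, isControllable_referenceMatrix ρ⟩
  · ext i j
    rw [Matrix.add_apply, rectOne_mul_apply, mul_apply]
    simp only [M, of_apply, mul_ite, mul_one, mul_zero, sum_ite_val_eq, rectOne, B, one_apply,
      Fin.ext_iff]
    split_ifs <;> first | omega | simp
  · ext i j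
    rw [Matrix.add_apply, rectOne_mul_apply, mul_apply]
    simp only [P, of_apply, mul_ite, mul_one, mul_zero, sum_ite_val_eq, B, diagonal_apply,
      Fin.ext_iff]
    split_ifs <;> first | omega | simp

theorem exists_hasObservableForm (h : n + m < ℓ) (ρ : 𝕜) :
    ∃ B : Matrix (Fin ℓ) (Fin m) 𝕜,
      HasObservableForm (rectOne 𝕜 ℓ n) (referenceMatrix ℓ n ρ) B := by
  let B : Matrix (Fin ℓ) (Fin m) 𝕜 := of fun i c => if (i : ℕ) = n + 1 + c then 1 else 0
  let M : Matrix (Fin m) (Fin ℓ) 𝕜 := of fun c j => if (j : ℕ) = n + 1 + c then 1 else 0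
  have hLE : rectOne 𝕜 n ℓ * rectOne 𝕜 ℓ n = 1 := by
    ext i j
    rw [rectOne_mul_apply, dif_pos (by omega), one_apply]
    simp only [rectOne, of_apply, Fin.ext_iff]
  have hLB : rectOne 𝕜 n ℓ * B = 0 := by
    ext i c
    rw [rectOne_mul_apply, dif_pos (by omega)]
    exact if_neg (show ¬ (i : ℕ) = n + 1 + c by omega)
  refine ⟨B, 1, rectOne 𝕜 n ℓ, M, of fun _ j => if (j : ℕ) = n then 1 else 0,
    hLE, hLB, ?_, ?_, ?_, ?_, isControllable_transpose_referenceMatrix (by omega) ρ⟩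
  all_goals
    ext i j
    simp only [B, M, mul_apply, rectOne, of_apply, ite_mul, one_mul, zero_mul, sum_ite_val_eq,
      one_apply, Matrix.zero_apply, Fin.ext_iff]
    split_ifs <;> first | omega | rfl

theorem exists_hasUnstableForm (h : ℓ = n + m) (hn : 0 < n) (hm : 0 < m) (ρ : 𝕜) :
    ∃ B : Matrix (Fin ℓ) (Fin m) 𝕜,
      HasUnstableForm (rectOne 𝕜 ℓ n) (referenceMatrix ℓ n ρ) B := by
  let β : 𝕜 := n * ρ + 1
  let B : Matrix (Fin ℓ) (Fin m) 𝕜 := of fun i c =>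
    if (i : ℕ) = n + c then 1 else if (i : ℕ) + 1 = n ∧ (c : ℕ) = 0 then β else 0
  let L : Matrix (Fin n) (Fin ℓ) 𝕜 := rectOne 𝕜 n ℓ -
    of fun (i : Fin n) (j : Fin ℓ) => if (j : ℕ) = n then if (i : ℕ) = n - 1 then β else 0 else 0
  let M : Matrix (Fin m) (Fin ℓ) 𝕜 := of fun c j =>
    if (c : ℕ) = j - n then if n ≤ j then 1 else 0 else 0
  have hLM : rectOne 𝕜 ℓ n * L + B * M = 1 := by
    ext i j
    rw [Matrix.add_apply, rectOne_mul_apply, mul_apply]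
    simp only [B, L, M, rectOne, Matrix.sub_apply, of_apply, mul_ite, mul_one, mul_zero,
      sum_ite_val_eq, one_apply, Fin.ext_iff]
    split_ifs <;> first | omega | simp
  have hdiag : ∀ i, (L * referenceMatrix ℓ n ρ) i i = -ρ + if (i : ℕ) = n - 1 then β else 0 := by
    intro i
    rw [Matrix.sub_mul, Matrix.sub_apply, rectOne_mul_apply, mul_apply]
    simp only [of_apply, ite_mul, zero_mul, sum_ite_val_eq, referenceMatrix_apply]
    split_ifs <;> first | omega | simp
  have htrace : (L * referenceMatrix ℓ n ρ).trace = 1 := by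
    simp only [trace, diag_apply, hdiag, Finset.sum_add_distrib, sum_ite_val_eq (fun _ => β)]
    simp [β, hn]
  obtain ⟨hLE, hLB⟩ := mul_eq_one_and_mul_eq_zero_of_right_inverse h hLM
  exact ⟨B, L, M, hLE, hLB, hLM, by simp [htrace]⟩

end Reference

/-! ### Density of the systems with `Q = S E` -/

section Density

variable {𝕜 : Type*} [RCLike 𝕜] {ℓ n m : ℕ}

open scoped MatrixOrder in
theorem exists_posSemidef_mul_mul_eq_self {M : Matrix (Fin n) (Fin n) 𝕜} (hM : M.PosSemidef) :
    ∃ N : Matrix (Fin n) (Fin n) 𝕜, N.PosSemidef ∧ M * N * M = M := by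
  have hsa : IsSelfAdjoint M := hM.1
  have hcont : ∀ f : ℝ → ℝ, ContinuousOn f (spectrum ℝ M) := M.finite_real_spectrum.continuousOn
  refine ⟨cfc (fun x : ℝ => x⁻¹) M, nonneg_iff_posSemidef.1 <| cfc_nonneg fun x hx =>
    inv_nonneg.2 (spectrum_nonneg_of_nonneg hM.nonneg hx), ?_⟩
  calc M * cfc (fun x : ℝ => x⁻¹) M * M
      = cfc (fun x : ℝ => x * x⁻¹ * x) M := by
        rw [cfc_mul _ _ M (hcont _) (hcont _), cfc_mul _ _ M (hcont _) (hcont _), cfc_id' ℝ M]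
    _ = M := by simp only [mul_inv_mul_cancel, cfc_id' ℝ M]

open scoped MatrixOrder in
theorem exists_posSemidef_mul_add_smul_eq {E Q : Matrix (Fin ℓ) (Fin n) 𝕜}
    (hEQ : (Eᴴ * Q).PosSemidef) {ε : ℝ} (hε : 0 < ε) :
    ∃ S : Matrix (Fin ℓ) (Fin ℓ) 𝕜, S.PosSemidef ∧ Q = S * (E + ε • Q) := by
  set M := Eᴴ * Q + ε • (Qᴴ * Q) with hM
  have hEM : Qᴴ * (E + ε • Q) = M := by
    rw [hM, ← hEQ.1.eq, conjTranspose_mul, conjTranspose_conjTranspose, Matrix.mul_add,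
      Matrix.mul_smul]
  obtain ⟨N, hN, hMN⟩ := exists_posSemidef_mul_mul_eq_self
    (hEQ.add ((posSemidef_conjTranspose_mul_self Q).smul hε.le))
  set X := 1 - N * M with hX
  have hMX : M * X = 0 := by
    rw [hX, Matrix.mul_sub, Matrix.mul_one, ← Matrix.mul_assoc, hMN, sub_self]
  have hsum : Xᴴ * (Eᴴ * Q) * X + ε • ((Q * X)ᴴ * (Q * X)) = 0 := by
    rw [← Matrix.mul_zero Xᴴ, ← hMX, hM, conjTranspose_mul]
    simp only [Matrix.add_mul, Matrix.mul_add, Matrix.smul_mul, Matrix.mul_smul, Matrix.mul_assoc]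
  have hQX : Q * X = 0 := by
    have h := (add_eq_zero_iff_of_nonneg (hEQ.conjTranspose_mul_mul_same X).nonneg
      ((posSemidef_conjTranspose_mul_self (Q * X)).smul hε.le).nonneg).1 hsum
    exact conjTranspose_mul_self_eq_zero.1 ((smul_eq_zero.1 h.2).resolve_left hε.ne')
  refine ⟨Q * N * Qᴴ, hN.mul_mul_conjTranspose_same Q, ?_⟩
  rw [Matrix.mul_assoc, hEM, Matrix.mul_assoc, ← sub_eq_zero, ← hQX, hX, Matrix.mul_sub,
    Matrix.mul_one]

theorem posSemidef_conjTranspose_mul_lineMap_mul {S : Matrix (Fin ℓ) (Fin ℓ) 𝕜}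
    (hS : S.PosSemidef) (E : Matrix (Fin ℓ) (Fin n) 𝕜) {t : ℝ} (ht : t ∈ Set.Icc (0 : ℝ) 1) :
    (Eᴴ * ((S + t • (1 - S)) * E)).PosSemidef := by
  have hSt : S + t • (1 - S) = (1 - t) • S + t • 1 := by module
  rw [hSt, ← Matrix.mul_assoc]
  exact ((hS.smul (sub_nonneg.2 ht.2)).add
    (PosSemidef.one.smul ht.1)).conjTranspose_mul_mul_same E

/-- The tuples `(E, d, Q, B)` with `Eᴴ Q ≥ 0` and with `d` in a prescribed set `D`. The parameter
`d` stands for `J` in the conservative and for `(J, R)` in the dissipative case. -/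
def hamiltonianSet (𝕜 : Type*) [RCLike 𝕜] (ℓ n m : ℕ) {P : Type*} (D : Set P) :
    Set (Matrix (Fin ℓ) (Fin n) 𝕜 × P × Matrix (Fin ℓ) (Fin n) 𝕜 × Matrix (Fin ℓ) (Fin m) 𝕜) :=
  {v | v.2.1 ∈ D ∧ (v.1ᴴ * v.2.2.1).PosSemidef}

variable {P : Type*} [AddCommGroup P] [Module ℝ P] {D : Set P}

theorem mem_quadraticStar_hamiltonianSet (hD : Convex ℝ D) {d d₁ : P} (hd : d ∈ D) (hd₁ : d₁ ∈ D)
    (E E₁ : Matrix (Fin ℓ) (Fin n) 𝕜) {S : Matrix (Fin ℓ) (Fin ℓ) 𝕜} (hS : S.PosSemidef)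
    (B B₁ : Matrix (Fin ℓ) (Fin m) 𝕜) :
    (E, d, S * E, B) ∈ quadraticStar (hamiltonianSet 𝕜 ℓ n m D) (E₁, d₁, E₁, B₁) := by
  refine ⟨(E₁ - E, d₁ - d, (1 - S) * E + S * (E₁ - E), B₁ - B),
    (0, 0, (1 - S) * (E₁ - E), 0), ?_, fun t ht => ⟨?_, ?_⟩⟩
  · ext1
    · simp
    ext1
    · simp
    ext1
    · simp only [Prod.snd_add, Prod.fst_add, Matrix.mul_sub, Matrix.sub_mul, Matrix.one_mul]
      abel
    · simp
  · simpa using hD.add_smul_sub_mem hd hd₁ ht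
  · convert posSemidef_conjTranspose_mul_lineMap_mul hS (E + t • (E₁ - E)) ht using 2
    · simp
    · simp only [Prod.snd_add, Prod.fst_add, Prod.smul_snd, Prod.smul_fst, Matrix.add_mul,
        Matrix.mul_add, Matrix.smul_mul, Matrix.mul_smul]
      module

theorem hamiltonianSet_subset_closure_quadraticStar [TopologicalSpace P] (hD : Convex ℝ D) {d₁ : P}
    (hd₁ : d₁ ∈ D) (E₁ : Matrix (Fin ℓ) (Fin n) 𝕜) (B₁ : Matrix (Fin ℓ) (Fin m) 𝕜) :
    hamiltonianSet 𝕜 ℓ n m D ⊆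
      closure (quadraticStar (hamiltonianSet 𝕜 ℓ n m D) (E₁, d₁, E₁, B₁)) := by
  rintro ⟨E, d, Q, B⟩ ⟨hd, hEQ⟩
  have hlim : Tendsto (fun ε : ℝ => E + ε • Q) (𝓝[>] 0) (𝓝 E) := by
    have hc : Continuous fun ε : ℝ => E + ε • Q := by fun_prop
    simpa using (hc.tendsto 0).mono_left (nhdsWithin_le_nhds (s := Set.Ioi 0))
  refine mem_closure_of_tendsto (hlim.prodMk_nhds (tendsto_const_nhds (x := (d, Q, B)))) ?_
  filter_upwards [self_mem_nhdsWithin] with ε hε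
  obtain ⟨S, hS, hQ⟩ := exists_posSemidef_mul_add_smul_eq hEQ hε
  generalize E + ε • Q = E' at hQ ⊢
  subst hQ
  exact mem_quadraticStar_hamiltonianSet hD hd hd₁ E' E₁ hS B B₁

theorem preimage_quadraticStar {W W' : Type*} [AddCommGroup W] [Module ℝ W] [AddCommGroup W']
    [Module ℝ W'] (Φ : W ≃ₗ[ℝ] W') (V : Set W') (v₁ : W') :
    Φ ⁻¹' quadraticStar V v₁ = quadraticStar (Φ ⁻¹' V) (Φ.symm v₁) := by
  ext v
  simp only [quadraticStar, Set.mem_preimage, Set.mem_ofPred_eq, Φ.surjective.exists, map_add,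
    map_smul, Φ.eq_symm_apply]

end Density

/-! ### Genericity -/

section Genericity

variable {𝕜 : Type*} [RCLike 𝕜] {ℓ n m : ℕ} {W : Type*} [AddCommGroup W] [Module ℝ W]
  [TopologicalSpace W]

/-- The five assertions on stabilizability for a class `V` of systems, where `S P` is the set of
those systems in `V` that have the property `P`. -/
def StabilizabilityGenericity (S : SystemProperty 𝕜 ℓ n m → Set W) (V : Set W) : Prop :=
  (IsRelGeneric (S BehaviourallyStabilizable) V ↔ ℓ ≠ n + m) ∧
  (IsRelGeneric (S CompletelyStabilizable) V ↔ ℓ < n + m) ∧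
  (IsRelGeneric (S StronglyStabilizable) V ↔ ℓ < n + m) ∧
  (ℓ > n + m →
    IsRelGeneric (S CompletelyStabilizable)ᶜ V ∧ IsRelGeneric (S StronglyStabilizable)ᶜ V) ∧
  (ℓ = n + m →
    HasNonemptyRelInterior (S BehaviourallyStabilizable)ᶜ V ∧
    HasNonemptyRelInterior (S CompletelyStabilizable)ᶜ V ∧
    HasNonemptyRelInterior (S StronglyStabilizable)ᶜ V)

/-- `V` is a class of systems `(E v, A v, B v)` depending polynomially on `v`. It contains the
reference systems with arbitrary input matrices, and each of them is joined to a dense set of points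
of `V` by quadratic curves in `V`. -/
structure IsReferenceFamily (V : Set W) (E A : W → Matrix (Fin ℓ) (Fin n) 𝕜)
    (B : W → Matrix (Fin ℓ) (Fin m) 𝕜) (ρ : 𝕜) : Prop where
  isPolyMatrix_E : IsPolyMatrix E
  isPolyMatrix_A : IsPolyMatrix A
  isPolyMatrix_B : IsPolyMatrix B
  exists_reference : ∀ B₁ : Matrix (Fin ℓ) (Fin m) 𝕜, ∃ v₁ ∈ V, E v₁ = rectOne 𝕜 ℓ n ∧
    A v₁ = referenceMatrix ℓ n ρ ∧ B v₁ = B₁ ∧ V ⊆ closure (quadraticStar V v₁)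

namespace IsReferenceFamily

variable [IsTopologicalAddGroup W] [ContinuousSMul ℝ W] [T2Space W] [FiniteDimensional ℝ W]
  {V T : Set W} {E A : W → Matrix (Fin ℓ) (Fin n) 𝕜} {B : W → Matrix (Fin ℓ) (Fin m) 𝕜} {ρ : 𝕜}

theorem isRelGeneric_of_hasControllableForm (hV : IsReferenceFamily V E A B ρ) (h : ℓ < n + m)
    (hn : 0 < n) (hm : 0 < m) (hT : ∀ v ∈ V, HasControllableForm (E v) (A v) (B v) → v ∈ T) :
    IsRelGeneric T V := by
  obtain ⟨B₁, hform⟩ := exists_hasControllableForm h hn hm ρ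
  obtain ⟨v₁, -, hE₁, hA₁, rfl, hdense⟩ := hV.exists_reference B₁
  rw [← hE₁, ← hA₁] at hform
  exact isRelGeneric_of_eventually_zariskiNhds hdense <| (hform.eventually_zariskiNhds
    hV.isPolyMatrix_E hV.isPolyMatrix_A hV.isPolyMatrix_B).mono fun v h hv => hT v hv h

theorem isRelGeneric_of_hasObservableForm (hV : IsReferenceFamily V E A B ρ) (h : n + m < ℓ)
    (hT : ∀ v ∈ V, HasObservableForm (E v) (A v) (B v) → v ∈ T) :
    IsRelGeneric T V ∧ HasNonemptyRelInterior T V := by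
  obtain ⟨B₁, hform⟩ := exists_hasObservableForm (m := m) h ρ
  obtain ⟨v₁, hv₁, hE₁, hA₁, rfl, hdense⟩ := hV.exists_reference B₁
  rw [← hE₁, ← hA₁] at hform
  have hnear := (hform.eventually_zariskiNhds
    hV.isPolyMatrix_E hV.isPolyMatrix_A hV.isPolyMatrix_B).mono fun v h hv => hT v hv h
  exact ⟨isRelGeneric_of_eventually_zariskiNhds hdense hnear,
    hasNonemptyRelInterior_of_eventually_nhds hv₁ (nhds_le_zariskiNhds v₁ hnear)⟩

theorem hasNonemptyRelInterior_of_hasUnstableForm (hV : IsReferenceFamily V E A B ρ)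
    (h : ℓ = n + m) (hn : 0 < n) (hm : 0 < m)
    (hT : ∀ v ∈ V, HasUnstableForm (E v) (A v) (B v) → v ∈ T) : HasNonemptyRelInterior T V := by
  obtain ⟨B₁, hform⟩ := exists_hasUnstableForm h hn hm ρ
  obtain ⟨v₁, hv₁, hE₁, hA₁, rfl, -⟩ := hV.exists_reference B₁
  rw [← hE₁, ← hA₁] at hform
  exact hasNonemptyRelInterior_of_eventually_nhds hv₁ <| (hform.eventually_nhds h
    hV.isPolyMatrix_E.continuous hV.isPolyMatrix_A.continuous
    hV.isPolyMatrix_B.continuous).mono fun v h hv => hT v hv h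

theorem isRelGeneric_iff_lt (hV : IsReferenceFamily V E A B ρ) (hn : 0 < n) (hm : 0 < m)
    (hctrl : ∀ v ∈ V, HasControllableForm (E v) (A v) (B v) → v ∈ T)
    (hobs : ∀ v ∈ V, HasObservableForm (E v) (A v) (B v) → v ∉ T)
    (hunst : ∀ v ∈ V, HasUnstableForm (E v) (A v) (B v) → v ∉ T) :
    IsRelGeneric T V ↔ ℓ < n + m := by
  refine ⟨fun hT => lt_of_not_ge fun hge => ?_,
    fun h => hV.isRelGeneric_of_hasControllableForm h hn hm hctrl⟩
  refine not_isRelGeneric_of_hasNonemptyRelInterior ?_ hT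
  obtain h | h := hge.eq_or_lt
  · exact hV.hasNonemptyRelInterior_of_hasUnstableForm h.symm hn hm hunst
  · exact (hV.isRelGeneric_of_hasObservableForm h hobs).2

theorem isRelGeneric_iff_ne (hV : IsReferenceFamily V E A B ρ) (hn : 0 < n) (hm : 0 < m)
    (hctrl : ∀ v ∈ V, HasControllableForm (E v) (A v) (B v) → v ∈ T)
    (hobs : ∀ v ∈ V, HasObservableForm (E v) (A v) (B v) → v ∈ T)
    (hunst : ∀ v ∈ V, HasUnstableForm (E v) (A v) (B v) → v ∉ T) :
    IsRelGeneric T V ↔ ℓ ≠ n + m := by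
  refine ⟨fun hT h => not_isRelGeneric_of_hasNonemptyRelInterior
    (hV.hasNonemptyRelInterior_of_hasUnstableForm h hn hm hunst) hT, fun h => ?_⟩
  obtain h | h := h.lt_or_gt
  · exact hV.isRelGeneric_of_hasControllableForm h hn hm hctrl
  · exact (hV.isRelGeneric_of_hasObservableForm h hobs).1

theorem stabilizabilityGenericity (hV : IsReferenceFamily V E A B ρ) (hn : 0 < n) (hm : 0 < m)
    {S : SystemProperty 𝕜 ℓ n m → Set W} (hS : ∀ P v, v ∈ S P ↔ v ∈ V ∧ P (E v) (A v) (B v)) :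
    StabilizabilityGenericity S V := by
  have mem {P v} (hv : v ∈ V) (hP : P (E v) (A v) (B v)) : v ∈ S P := (hS P v).2 ⟨hv, hP⟩
  have notMem {P v} (hP : ¬ P (E v) (A v) (B v)) : v ∉ S P := fun hv => hP ((hS P v).1 hv).2
  have behaviourally_unst : ∀ v ∈ V, HasUnstableForm (E v) (A v) (B v) →
      v ∉ S BehaviourallyStabilizable :=
    fun v _ h => notMem (h.not_behaviourallyStabilizable hn)
  have completely_obs : ∀ v ∈ V, HasObservableForm (E v) (A v) (B v) →
      v ∉ S CompletelyStabilizable :=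
    fun v _ h => notMem (h.not_completelyStabilizable hn)
  have strongly_obs : ∀ v ∈ V, HasObservableForm (E v) (A v) (B v) →
      v ∉ S StronglyStabilizable :=
    fun v _ h => notMem (h.not_stronglyStabilizable hn)
  have completely_unst : ∀ v ∈ V, HasUnstableForm (E v) (A v) (B v) →
      v ∉ S CompletelyStabilizable :=
    fun v _ h => notMem (h.not_completelyStabilizable hn)
  have strongly_unst : ∀ v ∈ V, HasUnstableForm (E v) (A v) (B v) →
      v ∉ S StronglyStabilizable :=
    fun v _ h => notMem (h.not_stronglyStabilizable hn)
  exact ⟨hV.isRelGeneric_iff_ne hn hm (fun v hv h => mem hv h.behaviourallyStabilizable)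
      (fun v hv h => mem hv h.behaviourallyStabilizable) behaviourally_unst,
    hV.isRelGeneric_iff_lt hn hm (fun v hv h => mem hv h.completelyStabilizable)
      completely_obs completely_unst,
    hV.isRelGeneric_iff_lt hn hm (fun v hv h => mem hv h.stronglyStabilizable)
      strongly_obs strongly_unst,
    fun h => ⟨(hV.isRelGeneric_of_hasObservableForm h completely_obs).1,
      (hV.isRelGeneric_of_hasObservableForm h strongly_obs).1⟩,
    fun h => ⟨hV.hasNonemptyRelInterior_of_hasUnstableForm h hn hm behaviourally_unst,
      hV.hasNonemptyRelInterior_of_hasUnstableForm h hn hm completely_unst,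
      hV.hasNonemptyRelInterior_of_hasUnstableForm h hn hm strongly_unst⟩⟩

end IsReferenceFamily

theorem isReferenceFamily_preimage_hamiltonianSet {P : Type*} [AddCommGroup P] [Module ℝ P]
    [TopologicalSpace P] {D : Set P} (hD : Convex ℝ D) {d₁ : P} (hd₁ : d₁ ∈ D)
    (F : P →ₗ[ℝ] Matrix (Fin ℓ) (Fin ℓ) 𝕜) {ρ : 𝕜} (hF : F d₁ = skewTridiag 𝕜 ℓ - ρ • 1)
    (Φ : W ≃L[ℝ] Matrix (Fin ℓ) (Fin n) 𝕜 × P × Matrix (Fin ℓ) (Fin n) 𝕜 ×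
      Matrix (Fin ℓ) (Fin m) 𝕜) :
    IsReferenceFamily (Φ ⁻¹' hamiltonianSet 𝕜 ℓ n m D) (fun v => (Φ v).1)
      (fun v => F (Φ v).2.1 * (Φ v).2.2.1) (fun v => (Φ v).2.2.2) ρ where
  isPolyMatrix_E := .linear (.fst ℝ _ _ ∘ₗ Φ.toLinearMap)
  isPolyMatrix_A :=
    .mul (.linear (F ∘ₗ .fst ℝ _ _ ∘ₗ .snd ℝ _ _ ∘ₗ Φ.toLinearMap))
      (.linear (.fst ℝ _ _ ∘ₗ .snd ℝ _ _ ∘ₗ .snd ℝ _ _ ∘ₗ Φ.toLinearMap))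
  isPolyMatrix_B := .linear (.snd ℝ _ _ ∘ₗ .snd ℝ _ _ ∘ₗ .snd ℝ _ _ ∘ₗ Φ.toLinearMap)
  exists_reference B₁ := by
    let w₁ := (rectOne 𝕜 ℓ n, d₁, rectOne 𝕜 ℓ n, B₁)
    have hw₁ : Φ (Φ.symm w₁) = w₁ := Φ.apply_symm_apply w₁
    refine ⟨Φ.symm w₁, ?_, ?_, ?_, ?_, ?_⟩
    · rw [Set.mem_preimage, hw₁]
      exact ⟨hd₁, posSemidef_conjTranspose_mul_self _⟩
    · rw [hw₁]
    · rw [hw₁, hF, referenceMatrix]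
    · rw [hw₁]
    · have h := Set.preimage_mono (f := Φ)
        (hamiltonianSet_subset_closure_quadraticStar hD hd₁ (rectOne 𝕜 ℓ n) B₁)
      rw [Φ.preimage_closure] at h
      exact h.trans_eq (congrArg closure (preimage_quadraticStar Φ.toLinearEquiv _ w₁))

theorem convex_eq_neg_conjTranspose :
    Convex ℝ {J : Matrix (Fin ℓ) (Fin ℓ) 𝕜 | J = -Jᴴ} := by
  intro J hJ K hK a b _ _ _
  rw [Set.mem_ofPred_eq] at *
  rw [conjTranspose_add, conjTranspose_smul, conjTranspose_smul, star_trivial, star_trivial,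
    neg_add, ← smul_neg, ← smul_neg, ← hJ, ← hK]

theorem convex_posSemidef : Convex ℝ {R : Matrix (Fin ℓ) (Fin ℓ) 𝕜 | R.PosSemidef} :=
  fun _ hR _ hS _ _ ha hb _ => (PosSemidef.smul hR ha).add (PosSemidef.smul hS hb)

theorem convex_posDef : Convex ℝ {R : Matrix (Fin ℓ) (Fin ℓ) 𝕜 | R.PosDef} :=
  convex_iff_forall_pos.2 fun _ hR _ hS _ _ ha hb _ => (PosDef.smul hR ha).add (PosDef.smul hS hb)

theorem conjTranspose_mul_comm_of_posSemidef {E Q : Matrix (Fin ℓ) (Fin n) 𝕜}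
    (h : (Eᴴ * Q).PosSemidef) : Eᴴ * Q = Qᴴ * E := by
  rw [← h.1.eq, conjTranspose_mul, conjTranspose_conjTranspose]

instance finiteDimensional_matrix_prod {k l : ℕ} {N : Type*} [AddCommGroup N] [Module ℝ N]
    [FiniteDimensional ℝ N] : FiniteDimensional ℝ (Matrix (Fin k) (Fin l) 𝕜 × N) :=
  Module.Finite.prod

theorem stabilizabilityGenericity_setH (hn : 0 < n) (hm : 0 < m) :
    StabilizabilityGenericity setH (SigmaH 𝕜 ℓ n m) := by
  have hV := isReferenceFamily_preimage_hamiltonianSet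
    (convex_eq_neg_conjTranspose (𝕜 := 𝕜) (ℓ := ℓ)) (d₁ := skewTridiag 𝕜 ℓ)
    skewTridiag_eq_neg_conjTranspose .id (ρ := 0) (by simp)
    (.refl ℝ (Quadruple 𝕜 ℓ n m))
  have hSigma : SigmaH 𝕜 ℓ n m = hamiltonianSet 𝕜 ℓ n m {J | J = -Jᴴ} :=
    Set.ext fun v => ⟨fun ⟨hJ, _, hEQ⟩ => ⟨hJ, hEQ⟩,
      fun ⟨hJ, hEQ⟩ => ⟨hJ, conjTranspose_mul_comm_of_posSemidef hEQ, hEQ⟩⟩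
  exact hSigma ▸ hV.stabilizabilityGenericity hn hm fun P v => hSigma ▸ Iff.rfl

/-- The identification of `(E, J, R, Q, B)` with `(E, (J, R), Q, B)`. -/
noncomputable def quintupleEquiv (𝕜 : Type*) [RCLike 𝕜] (ℓ n m : ℕ) :
    Quintuple 𝕜 ℓ n m ≃L[ℝ] Matrix (Fin ℓ) (Fin n) 𝕜 ×
      (Matrix (Fin ℓ) (Fin ℓ) 𝕜 × Matrix (Fin ℓ) (Fin ℓ) 𝕜) × Matrix (Fin ℓ) (Fin n) 𝕜 ×
        Matrix (Fin ℓ) (Fin m) 𝕜 :=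
  (ContinuousLinearEquiv.refl ℝ _).prodCongr (ContinuousLinearEquiv.prodAssoc ℝ _ _ _).symm

theorem stabilizabilityGenericity_dissipative (hn : 0 < n) (hm : 0 < m)
    {C : Set (Matrix (Fin ℓ) (Fin ℓ) 𝕜)} (hC : Convex ℝ C) (h₁ : 1 ∈ C)
    {V : Set (Quintuple 𝕜 ℓ n m)} (hV : ∀ E J R Q B, (E, J, R, Q, B) ∈ V ↔
      J = -Jᴴ ∧ R ∈ C ∧ Eᴴ * Q = Qᴴ * E ∧ (Eᴴ * Q).PosSemidef)
    {S : SystemProperty 𝕜 ℓ n m → Set (Quintuple 𝕜 ℓ n m)}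
    (hS : ∀ P E J R Q B, (E, J, R, Q, B) ∈ S P ↔
      (E, J, R, Q, B) ∈ V ∧ P E ((J - R) * Q) B) :
    StabilizabilityGenericity S V := by
  have href := isReferenceFamily_preimage_hamiltonianSet (convex_eq_neg_conjTranspose.prod hC)
    (d₁ := (skewTridiag 𝕜 ℓ, 1)) (Set.mk_mem_prod skewTridiag_eq_neg_conjTranspose h₁)
    (.fst ℝ _ _ - .snd ℝ _ _) (ρ := 1) (by simp) (quintupleEquiv 𝕜 ℓ n m)
  have hVeq : V = quintupleEquiv 𝕜 ℓ n m ⁻¹' hamiltonianSet 𝕜 ℓ n m ({J | J = -Jᴴ} ×ˢ C) := by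
    ext ⟨E, J, R, Q, B⟩
    exact (hV E J R Q B).trans ⟨fun ⟨hJ, hR, _, hEQ⟩ => ⟨⟨hJ, hR⟩, hEQ⟩,
      fun ⟨⟨hJ, hR⟩, hEQ⟩ => ⟨hJ, hR, conjTranspose_mul_comm_of_posSemidef hEQ, hEQ⟩⟩
  rw [← hVeq] at href
  exact href.stabilizabilityGenericity hn hm fun P v => hS P _ _ _ _ _

end Genericity

end PortHamiltonian

theorem mainTheorem2 (𝕜 : Type*) [RCLike 𝕜] (ℓ n m : ℕ)
    (hℓ : 0 < ℓ) (hn : 0 < n) (hm : 0 < m) :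
    ((IsRelGeneric (setH BehaviourallyStabilizable) (SigmaH 𝕜 ℓ n m) ↔ ℓ ≠ n + m) ∧
      (IsRelGeneric (setH CompletelyStabilizable) (SigmaH 𝕜 ℓ n m) ↔ ℓ < n + m) ∧
      (IsRelGeneric (setH StronglyStabilizable) (SigmaH 𝕜 ℓ n m) ↔ ℓ < n + m) ∧
      (ℓ > n + m →
        IsRelGeneric (setH CompletelyStabilizable)ᶜ (SigmaH 𝕜 ℓ n m) ∧
        IsRelGeneric (setH StronglyStabilizable)ᶜ (SigmaH 𝕜 ℓ n m)) ∧
      (ℓ = n + m →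
        HasNonemptyRelInterior (setH BehaviourallyStabilizable)ᶜ (SigmaH 𝕜 ℓ n m) ∧
        HasNonemptyRelInterior (setH CompletelyStabilizable)ᶜ (SigmaH 𝕜 ℓ n m) ∧
        HasNonemptyRelInterior (setH StronglyStabilizable)ᶜ (SigmaH 𝕜 ℓ n m))) ∧
    ((IsRelGeneric (setSDH BehaviourallyStabilizable) (SigmaSDH 𝕜 ℓ n m) ↔ ℓ ≠ n + m) ∧
      (IsRelGeneric (setSDH CompletelyStabilizable) (SigmaSDH 𝕜 ℓ n m) ↔ ℓ < n + m) ∧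
      (IsRelGeneric (setSDH StronglyStabilizable) (SigmaSDH 𝕜 ℓ n m) ↔ ℓ < n + m) ∧
      (ℓ > n + m →
        IsRelGeneric (setSDH CompletelyStabilizable)ᶜ (SigmaSDH 𝕜 ℓ n m) ∧
        IsRelGeneric (setSDH StronglyStabilizable)ᶜ (SigmaSDH 𝕜 ℓ n m)) ∧
      (ℓ = n + m →
        HasNonemptyRelInterior (setSDH BehaviourallyStabilizable)ᶜ (SigmaSDH 𝕜 ℓ n m) ∧
        HasNonemptyRelInterior (setSDH CompletelyStabilizable)ᶜ (SigmaSDH 𝕜 ℓ n m) ∧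
        HasNonemptyRelInterior (setSDH StronglyStabilizable)ᶜ (SigmaSDH 𝕜 ℓ n m))) ∧
    ((IsRelGeneric (setDH BehaviourallyStabilizable) (SigmaDH 𝕜 ℓ n m) ↔ ℓ ≠ n + m) ∧
      (IsRelGeneric (setDH CompletelyStabilizable) (SigmaDH 𝕜 ℓ n m) ↔ ℓ < n + m) ∧
      (IsRelGeneric (setDH StronglyStabilizable) (SigmaDH 𝕜 ℓ n m) ↔ ℓ < n + m) ∧
      (ℓ > n + m →
        IsRelGeneric (setDH CompletelyStabilizable)ᶜ (SigmaDH 𝕜 ℓ n m) ∧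
        IsRelGeneric (setDH StronglyStabilizable)ᶜ (SigmaDH 𝕜 ℓ n m)) ∧
      (ℓ = n + m →
        HasNonemptyRelInterior (setDH BehaviourallyStabilizable)ᶜ (SigmaDH 𝕜 ℓ n m) ∧
        HasNonemptyRelInterior (setDH CompletelyStabilizable)ᶜ (SigmaDH 𝕜 ℓ n m) ∧
        HasNonemptyRelInterior (setDH StronglyStabilizable)ᶜ (SigmaDH 𝕜 ℓ n m))) := by
  refine ⟨stabilizabilityGenericity_setH hn hm, ?_, ?_⟩
  · exact stabilizabilityGenericity_dissipative hn hm convex_posSemidef PosSemidef.one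
      (fun _ _ _ _ _ => Iff.rfl) fun _ _ _ _ _ _ => Iff.rfl
  · exact stabilizabilityGenericity_dissipative hn hm convex_posDef PosDef.one
      (fun _ _ _ _ _ => Iff.rfl) fun _ _ _ _ _ _ => Iff.rfl
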